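/- Setting. Use cylindrical coordinates $\rho,\varphi,\zeta$ on $\mathbb R^3$ with rotation axis $\rho=0$, and consider the line element $$ds^2=e^{-2U}\left[e^{2k}(d\rho^2+d\zeta^2)+\rho^2d\varphi^2\right]-e^{2U}(dt+a\,d\varphi)^2 .$$ Let $\Omega\subset\mathbb R^3$ be an open set with continuously differentiable boundary, let $U,a,k\in C^2(\Omega)$ depend only on $(\rho,\zeta)$, and let the mass density $\mu=\mu(\rho,\zeta)$ satisfy $\mu\ge 0$ and $\mu\neq0$ everywhere in $\Omega$. Assume that the origin lies in $\Omega$, and that the spacetime is elementarily flat at the part $\mathcal A$ of the axis inside $\Omega$: with $X=g(\partial_\varphi,\partial_\varphi)=e^{-2U}\rho^2-e^{2U}a^2$, one has $g^{ij}X_{,i}X_{,j}/(4X)\to1$ at every point of $\mathcal A$. Assume $U=U_0$ is constant in $\Omega$, as is the case for rigidly rotating dust. A function $b=b(\rho,\zeta)\in C^2(\Omega)$ is a solution of the field equations if in $\Omega$ $$\Delta b=0,\qquad (\nabla b)^2=8\pi\mu e^{2k+2U_0},\qquad k=\frac{e^{-4U_0}}4\int\rho\left[\big((b_{,\rho})^2-(b_{,\zeta})^2\big)d\rho+2b_{,\rho}b_{,\zeta}\,d\zeta\right],$$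 where $\Delta$ and $\nabla$ are those of Euclidean $\mathbb R^3$ and the last equation means that $k$ is a primitive of the given one-form off the axis. Theorem. Assume moreover that $\zeta\mapsto\mu(0,\zeta)$ is real analytic in a neighbourhood of $\zeta=0$, and let $\epsilon\in(0,\infty]$ be the radius of convergence of its Taylor series at $0$. Let $b$ be a solution of the field equations. Let $B_\sigma$ denote the open ball of radius $\sigma$ about the origin. Then there are $\sigma>0$ with $B_\sigma\subset B_\epsilon\cap\Omega$, and for every such $\sigma$ the following holds. There is a choice of sign $\pm$ such that, in polar coordinates $\rho=r\sin\theta$, $\zeta=r\cos\theta$, for all points of $B_\sigma$ $$b=b(0)\pm\sqrt{8\pi e^{2U_0}}\sum_{l=1}^\infty\frac1{l!}\,(\sqrt\mu)^{(l-1)}\,r^l\,P_l(\cos\theta),$$ where the series converges, $(\sqrt\mu)^{(n)}$ is the $n$-th derivative of $\zeta\mapsto\sqrt{\mu(0,\zeta)}$ at $\zeta=0$, and $P_l$ are the Legendre polynomials. Conversely, the additive constant and the sign are arbitrary: for every $c\in\mathbb R$ and each sign there is a solution of the field equations in $\Omega$, with the same $\mu,k,U_0$, that has the value $c$ at the origin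 and is given in $B_\sigma$ by this formula with $b(0)$ replaced by $c$ and with that sign. -/

import Mathlib

open scoped Topology Laplacian

noncomputable section

namespace RotatingDust

/-- Euclidean three-space with Cartesian coordinates `(x 0, x 1, x 2)`; the rotation axis is the
third coordinate axis. -/
abbrev E3 : Type := EuclideanSpace ℝ (Fin 3)

/-- The cylindrical radius `ρ`. -/
def rho (x : E3) : ℝ := Real.sqrt (x 0 ^ 2 + x 1 ^ 2)

/-- The cylindrical height `ζ`. -/
def zeta (x : E3) : ℝ := x 2

/-- The axis of rotation `ρ = 0`. -/
def axis : Set E3 := {x | rho x = 0}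

/-- The point of the axis of rotation with height `z`. -/
def axisPoint (z : ℝ) : E3 := !₂[0, 0, z]

/-- `f` depends on the coordinates `ρ, ζ` only, in `Ω`. -/
def DependsOnRhoZeta (f : E3 → ℝ) (Ω : Set E3) : Prop :=
  ∀ x ∈ Ω, ∀ y ∈ Ω, rho x = rho y → zeta x = zeta y → f x = f y

/-- The unit vector `e_ρ` at a point off the axis. -/
def eRho (x : E3) : E3 := !₂[x 0 / rho x, x 1 / rho x, 0]

/-- The unit vector `e_ζ`. -/
def eZeta : E3 := !₂[0, 0, 1]

/-- The partial derivative `f_{,ρ}` at a point off the axis. -/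
def dRho (f : E3 → ℝ) (x : E3) : ℝ := fderiv ℝ f x (eRho x)

/-- The partial derivative `f_{,ζ}`. -/
def dZeta (f : E3 → ℝ) (x : E3) : ℝ := fderiv ℝ f x eZeta

/-- The boundary of `Ω` is a continuously differentiable surface: locally the regular zero set of
a `C¹` function. -/
def HasC1Boundary (Ω : Set E3) : Prop :=
  ∀ p ∈ frontier Ω, ∃ V : Set E3, IsOpen V ∧ p ∈ V ∧ ∃ g : E3 → ℝ,
    ContDiffOn ℝ 1 g V ∧ (∀ x ∈ V, fderiv ℝ g x ≠ 0) ∧ frontier Ω ∩ V = {x ∈ V | g x = 0}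

/-- The Lewis-Papapetrou line element with `W = ρ`,
`ds² = e^{-2U} (e^{2k} (dρ² + dζ²) + ρ² dφ²) - e^{2U} (dt + a dφ)²`,
as the matrix of metric coefficients with respect to the coordinates `(t, ρ, φ, ζ)`. -/
def metric (U a k : E3 → ℝ) (x : E3) : Matrix (Fin 4) (Fin 4) ℝ :=
  !![-Real.exp (2 * U x), 0, -(Real.exp (2 * U x) * a x), 0;
     0, Real.exp (2 * k x - 2 * U x), 0, 0;
     -(Real.exp (2 * U x) * a x), 0,
       Real.exp (-2 * U x) * rho x ^ 2 - Real.exp (2 * U x) * a x ^ 2, 0;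
     0, 0, 0, Real.exp (2 * k x - 2 * U x)]

/-- The square `X = g(∂_φ, ∂_φ)` of the axial Killing vector field. -/
def axialNormSq (U a k : E3 → ℝ) (x : E3) : ℝ := metric U a k x 2 2

/-- The components of the differential of a function of `ρ, ζ` in the coordinates
`(t, ρ, φ, ζ)`. -/
def differential (f : E3 → ℝ) (x : E3) : Fin 4 → ℝ := ![0, dRho f x, 0, dZeta f x]

/-- The invariant `g^{ij} f_{,i} f_{,j}` of a function of `ρ, ζ`. -/
def gradNormSq (U a k f : E3 → ℝ) (x : E3) : ℝ :=
  dotProduct (differential f x) (Matrix.mulVec (metric U a k x)⁻¹ (differential f x))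

/-- Elementary flatness on the part of the rotation axis inside `Ω`:
`g^{ij} X_{,i} X_{,j} / (4 X) → 1` at the axis, with `X` the square of the axial Killing field. -/
def ElementarilyFlat (Ω : Set E3) (U a k : E3 → ℝ) : Prop :=
  ∀ p ∈ Ω ∩ axis,
    Filter.Tendsto
      (fun x => gradNormSq U a k (axialNormSq U a k) x / (4 * axialNormSq U a k x))
      (𝓝[axisᶜ] p) (𝓝 1)

/-- The regularity assumptions on the dust region `Ω`, the metric functions `U, a, k` and the mass
density `μ`. -/
structure RegularDust (Ω : Set E3) (U a k μ : E3 → ℝ) : Prop where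
  isOpen : IsOpen Ω
  c1Boundary : HasC1Boundary Ω
  U_symm : DependsOnRhoZeta U Ω
  a_symm : DependsOnRhoZeta a Ω
  k_symm : DependsOnRhoZeta k Ω
  μ_symm : DependsOnRhoZeta μ Ω
  μ_nonneg : ∀ x ∈ Ω, 0 ≤ μ x
  μ_ne_zero : ∀ x ∈ Ω, μ x ≠ 0
  U_contDiffOn : ContDiffOn ℝ 2 U Ω
  a_contDiffOn : ContDiffOn ℝ 2 a Ω
  k_contDiffOn : ContDiffOn ℝ 2 k Ω

/-- The rotation axis meets `Ω`, the origin is on it, and the spacetime is elementarily flat. -/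
structure RegularAxis (Ω : Set E3) (U a k : E3 → ℝ) : Prop where
  axis_nonempty : (Ω ∩ axis).Nonempty
  origin_mem : (0 : E3) ∈ Ω ∩ axis
  flat : ElementarilyFlat Ω U a k

/-- `b ∈ C²(Ω)`, a function of `ρ, ζ`, solves the field equations of rigidly rotating dust in `Ω`,
with constant `U = U₀`:
`Δ b = 0`, `(∇ b)² = 8 π μ e^{2 k + 2 U₀}`, and
`k = (e^{-4 U₀} / 4) ∫ ρ [((b_{,ρ})² - (b_{,ζ})²) dρ + 2 b_{,ρ} b_{,ζ} dζ]`,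
the last meaning that `k` is a primitive of this one-form. -/
structure SolvesFieldEquations (Ω : Set E3) (U₀ : ℝ) (k μ b : E3 → ℝ) : Prop where
  contDiffOn : ContDiffOn ℝ 2 b Ω
  symm : DependsOnRhoZeta b Ω
  harmonic : ∀ x ∈ Ω, Δ b x = 0
  grad_sq : ∀ x ∈ Ω,
    ‖gradient b x‖ ^ 2 = 8 * Real.pi * μ x * Real.exp (2 * k x + 2 * U₀)
  k_rho : ∀ x ∈ Ω \ axis,
    dRho k x = Real.exp (-4 * U₀) / 4 * (rho x * (dRho b x ^ 2 - dZeta b x ^ 2))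
  k_zeta : ∀ x ∈ Ω \ axis,
    dZeta k x = Real.exp (-4 * U₀) / 4 * (rho x * (2 * dRho b x * dZeta b x))

/-- The Legendre polynomial `P_l` of the first kind,
`P_l(t) = (1 / (2^l l!)) (d/dt)^l (t² - 1)^l`. -/
def legendre (l : ℕ) : Polynomial ℝ :=
  Polynomial.C (1 / (2 ^ l * (l.factorial : ℝ))) *
    (Polynomial.derivative^[l] ((Polynomial.X ^ 2 - 1) ^ l))

/-- The term `(1 / l!) (√μ)^{(l-1)} r^l P_l(cos θ)` for `l = n + 1`, where the derivative is the
`ζ`-derivative along the axis at the origin. -/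
def seriesTerm (μ : E3 → ℝ) (r θ : ℝ) (n : ℕ) : ℝ :=
  1 / ((n + 1).factorial : ℝ) * iteratedDeriv n (fun z => Real.sqrt (μ (axisPoint z))) 0 *
    r ^ (n + 1) * (legendre (n + 1)).eval (Real.cos θ)

/-- On `B_σ`, in polar coordinates `ρ = r sin θ`, `ζ = r cos θ`, the series converges and
`b = c + s √(8 π e^{2 U₀}) ∑_{l ≥ 1} (1 / l!) (√μ)^{(l-1)}(0) r^l P_l(cos θ)`. -/
def HasLocalForm (U₀ : ℝ) (μ : E3 → ℝ) (σ c s : ℝ) (b : E3 → ℝ) : Prop :=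
  ∀ x ∈ Metric.ball (0 : E3) σ, ∀ r θ : ℝ, 0 ≤ r →
    rho x = r * Real.sin θ → zeta x = r * Real.cos θ →
    Summable (seriesTerm μ r θ) ∧
      b x = c + s * Real.sqrt (8 * Real.pi * Real.exp (2 * U₀)) * ∑' n, seriesTerm μ r θ n

end RotatingDust

end

noncomputable section

namespace RotatingDust

/-! On the axis the field equations become explicit. Axisymmetry kills the horizontal derivatives of
`b` there, and elementary flatness with constant `U` forces `a = 0` and `k = 0`
(`k_eq_zero_on_axis`), so the second field equation reads `b_{,ζ}² = 8 π e^{2 U₀} μ`. The right side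
never vanishes and `b_{,ζ}` is continuous, so along the axis segment in the ball `b_{,ζ}` is one
fixed sign times the positive root (`exists_sign_deriv_axis`).

An axisymmetric harmonic function on a ball is determined by its values on the axis. Projection onto
`P_l (cos θ)` turns the Laplace equation into `r² c'' + 2 r c' = l (l + 1) c`, whose solutions
regular at `0` are multiples of `r ^ l` (`legendre_coefficient_eq`, `radial_equation`). The bound
`|P_l| ≤ 1` and the completeness of the Legendre polynomials then give a convergent expansion `∑ B_l
r^l P_l (cos θ)` (`exists_legendre_series`). Since `P_l (±1) = (±1)^l`, it restricts to a power
series on the axis, so `B_l` is the `l`-th axis derivative at the origin divided by `l!`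
(`hasSum_legendre_axis_derivs`). Inserting the value of `b_{,ζ}` on the axis gives the formula.

The converse holds because the equations are invariant under `b ↦ ±b + const`
(`SolvesFieldEquations.sign_mul_add_const`). -/

open Polynomial

/-! ### Legendre polynomials: differential equation, orthogonality, bound. -/

theorem derivative_iterate_rodrigues_ode (l : ℕ) :
    (X ^ 2 - 1 : ℝ[X]) * derivative^[l + 2] ((X ^ 2 - 1) ^ l)
      + 2 * X * derivative^[l + 1] ((X ^ 2 - 1) ^ l)
      - (l : ℝ[X]) * ((l : ℝ[X]) + 1) * derivative^[l] ((X ^ 2 - 1) ^ l) = 0 := by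
  set w : ℝ[X] := (X ^ 2 - 1) ^ l with hw
  -- The first-order equation `(X² - 1) w' = 2 l X w`; differentiating it `l + 1` times by the
  -- Leibniz rule gives the claim.
  have h0 : derivative w * X * X - derivative w = ((2 * l : ℕ) : ℝ[X]) * (w * X) := by
    rcases l with _ | l
    · simp [hw]
    · rw [hw, derivative_pow]
      simp
      ring
  have h1 := congrArg (fun q => derivative^[l + 1] q) h0
  simp only [iterate_derivative_sub, iterate_derivative_natCast_mul, iterate_derivative_mul_X (n := l + 1),
    iterate_derivative_derivative_mul_X, Nat.add_sub_cancel, nsmul_eq_mul,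
    ← Function.iterate_succ_apply] at h1
  simp only [Nat.succ_eq_add_one] at h1
  push_cast at h1
  linear_combination h1

theorem legendre_ode (l : ℕ) :
    derivative ((1 - X ^ 2) * derivative (legendre l)) = -(C ((l : ℝ) * (l + 1)) * legendre l) := by
  have h := derivative_iterate_rodrigues_ode l
  rw [Function.iterate_succ_apply', Function.iterate_succ_apply'] at h
  rw [legendre]
  generalize 1 / (2 ^ l * (l.factorial : ℝ)) = c
  simp only [derivative_mul, derivative_sub, derivative_C, derivative_one,
    derivative_X_sq, zero_mul, zero_add, zero_sub, map_mul, map_add, map_natCast, map_one,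
    map_ofNat]
  linear_combination (-(C c)) * h

/-- Factor `(X² - 1)^l = (X - 1)^l (X + 1)^l`: at `1` only the Leibniz term in which all `l`
derivatives fall on `(X - 1)^l` survives. -/
theorem legendre_eval_one (l : ℕ) : (legendre l).eval 1 = 1 := by
  have h : (derivative^[l] ((X ^ 2 - 1 : ℝ[X]) ^ l)).eval 1 = l.factorial * 2 ^ l := by
    have h1 : (X ^ 2 - 1 : ℝ[X]) ^ l = (X - C 1) ^ l * (X + C 1) ^ l := by
      rw [← mul_pow]; congr 1; simp; ring
    rw [h1, iterate_derivative_mul, eval_finsetSum, Finset.sum_eq_single 0]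
    · rw [Nat.sub_zero, iterate_derivative_X_sub_pow_self]
      simp
      norm_num
    · intro k hk hk0
      rw [iterate_derivative_X_sub_pow]
      have : l - (l - k) ≠ 0 := by
        simp only [Nat.succ_eq_add_one, Finset.mem_range] at hk; omega
      simp [this]
    · simp
  rw [legendre, eval_mul, eval_C, h]
  have := l.factorial_ne_zero
  field_simp

theorem legendre_eval_neg (l : ℕ) (x : ℝ) :
    (legendre l).eval (-x) = (-1) ^ l * (legendre l).eval x := by
  have h : ∀ (n : ℕ) (q : ℝ[X]), derivative^[n] (q.comp (-X)) =
      (-1) ^ n * (derivative^[n] q).comp (-X) := by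
    intro n
    induction n with
    | zero => simp
    | succ n ih =>
      intro q
      rw [Function.iterate_succ_apply, derivative_comp, Function.iterate_succ_apply]
      simp only [derivative_neg, derivative_X, neg_mul, one_mul, iterate_derivative_neg, ih]
      ring
  have h1 := congrArg (eval x) (h l ((X ^ 2 - 1) ^ l))
  have h2 : ((X ^ 2 - 1 : ℝ[X]) ^ l).comp (-X) = (X ^ 2 - 1) ^ l := by simp
  rw [h2] at h1
  simp only [eval_mul, eval_comp, eval_pow, eval_neg, eval_one, eval_X] at h1
  have h3 : ((-1 : ℝ) ^ l) * (-1) ^ l = 1 := by rw [← mul_pow]; simp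
  simp only [legendre, eval_mul, eval_C, h1]
  linear_combination (-(1 / (2 ^ l * (l.factorial : ℝ))) *
    eval (-x) (derivative^[l] ((X ^ 2 - 1) ^ l))) * h3

/-- Makes the degree of `P_l` exactly `l`, so that the `P_j` with `j < n` span the polynomials of
degree `< n`. -/
theorem legendre_coeff_self_ne_zero (l : ℕ) : (legendre l).coeff l ≠ 0 := by
  have hm : ((X ^ 2 - 1 : ℝ[X]) ^ l).coeff (l + l) = 1 := by
    have h1 : (X ^ 2 - 1 : ℝ[X]).Monic := by
      simpa using monic_X_pow_sub_C (1 : ℝ) (two_ne_zero)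
    have h2 : ((X ^ 2 - 1 : ℝ[X]) ^ l).natDegree = l + l := by
      rw [h1.natDegree_pow]
      have : (X ^ 2 - 1 : ℝ[X]).natDegree = 2 := by
        simpa using natDegree_X_pow_sub_C (n := 2) (r := (1 : ℝ))
      rw [this]; ring
    rw [← h2]; exact (h1.pow l).coeff_natDegree
  rw [legendre, coeff_C_mul, coeff_iterate_derivative, hm]
  have := l.factorial_ne_zero
  have h3 : (l + l).descFactorial l ≠ 0 := by
    rw [Ne, Nat.descFactorial_eq_zero_iff_lt]; omega
  simp [this, h3]

theorem legendre_natDegree (l : ℕ) : (legendre l).natDegree = l := by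
  apply le_antisymm
  · refine (natDegree_C_mul_le _ _).trans ((natDegree_iterate_derivative _ _).trans ?_)
    have : ((X ^ 2 - 1 : ℝ[X]) ^ l).natDegree ≤ l * 2 := by
      refine natDegree_pow_le_of_le l ?_
      simpa using (natDegree_X_pow_sub_C (n := 2) (r := (1 : ℝ))).le
    omega
  · exact le_natDegree_of_ne_zero (legendre_coeff_self_ne_zero l)

/-- A linear functional vanishing on `P_0, …, P_{n-1}` vanishes on polynomials of degree `< n`. -/
theorem eq_zero_of_legendre (L : ℝ[X] →ₗ[ℝ] ℝ) (n : ℕ) (h : ∀ j < n, L (legendre j) = 0) :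
    ∀ q : ℝ[X], q.degree < n → L q = 0 := by
  induction n with
  | zero =>
    intro q hq
    have : q = 0 := by simpa using hq
    simp [this]
  | succ n ih =>
    intro q hq
    -- Subtracting `c P_n` cancels the coefficient of degree `n`.
    set c := q.coeff n / (legendre n).coeff n
    have h1 : (q - c • legendre n).degree < n := by
      rw [degree_lt_iff_coeff_zero]
      intro m hm
      rcases hm.eq_or_lt with rfl | hm
      · have := legendre_coeff_self_ne_zero n
        simp [c, this]
      · have h2 : q.coeff m = 0 := coeff_eq_zero_of_degree_lt
          (hq.trans_le (by exact_mod_cast hm))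
        have h3 : (legendre n).coeff m = 0 :=
          coeff_eq_zero_of_natDegree_lt (by rwa [legendre_natDegree])
        simp [h2, h3]
    have h2 := ih (fun j hj => h j (by omega)) _ h1
    rw [map_sub, map_smul, h n (by omega)] at h2
    simpa using h2

/-- Integration of polynomials over `[-1, 1]` against a fixed continuous function. -/
def integralAgainst (g : ℝ → ℝ) (hg : ContinuousOn g (Set.Icc (-1) 1)) : ℝ[X] →ₗ[ℝ] ℝ where
  toFun q := ∫ t in (-1 : ℝ)..1, g t * q.eval t
  map_add' p q := by
    have h : ∀ r : ℝ[X], IntervalIntegrable (fun t => g t * r.eval t) MeasureTheory.volume (-1) 1 :=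
      fun r => ContinuousOn.intervalIntegrable (by
        rw [Set.uIcc_of_le (by norm_num)]
        exact hg.mul r.continuous.continuousOn)
    rw [← intervalIntegral.integral_add (h p) (h q)]
    simp [mul_add]
  map_smul' c q := by
    simp only [eval_smul, smul_eq_mul, RingHom.id_apply]
    rw [← intervalIntegral.integral_const_mul]
    congr 1; ext t; ring

theorem integral_eval_derivative (q : ℝ[X]) :
    ∫ t in (-1 : ℝ)..1, (derivative q).eval t = q.eval 1 - q.eval (-1) :=
  intervalIntegral.integral_eq_sub_of_hasDerivAt (fun x _ => q.hasDerivAt x)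
    ((derivative q).continuous.intervalIntegrable _ _)

/-- Sturm–Liouville argument: the Wronskian `(1 - X²) (P_l' P_m - P_m' P_l)` vanishes at `±1` and
has derivative `(m (m + 1) - l (l + 1)) P_l P_m`. -/
theorem integral_legendre_mul_of_ne {l m : ℕ} (h : l ≠ m) :
    ∫ t in (-1 : ℝ)..1, (legendre l).eval t * (legendre m).eval t = 0 := by
  have h1 := integral_eval_derivative
    ((1 - X ^ 2) * derivative (legendre l) * legendre m
      - (1 - X ^ 2) * derivative (legendre m) * legendre l)
  have h2 : derivative ((1 - X ^ 2) * derivative (legendre l) * legendre m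
      - (1 - X ^ 2) * derivative (legendre m) * legendre l)
      = C ((m : ℝ) * (m + 1) - l * (l + 1)) * (legendre l * legendre m) := by
    rw [derivative_sub, derivative_mul (g := legendre m), derivative_mul (g := legendre l),
      legendre_ode, legendre_ode, C_sub]
    ring
  rw [h2] at h1
  simp only [eval_mul, eval_C, eval_sub, eval_one, eval_pow, eval_X] at h1
  rw [intervalIntegral.integral_const_mul] at h1
  norm_num at h1
  rcases h1 with h1 | h1
  · exfalso
    have h3 : ((m : ℝ) - l) * (m + l + 1) = 0 := by linear_combination h1
    rcases mul_eq_zero.1 h3 with h3 | h3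
    · exact h (by exact_mod_cast (sub_eq_zero.1 h3).symm)
    · have : (0 : ℝ) < m + l + 1 := by positivity
      linarith
  · exact h1

theorem integral_legendre_mul_of_degree_lt {l : ℕ} {q : ℝ[X]} (hq : q.degree < l) :
    ∫ t in (-1 : ℝ)..1, (legendre l).eval t * q.eval t = 0 :=
  eq_zero_of_legendre (integralAgainst (fun t => (legendre l).eval t)
    (legendre l).continuous.continuousOn) l
    (fun _ hj => integral_legendre_mul_of_ne hj.ne') q hq

/-- Integrate the derivative of `X P_l²`. Since `X P_l' - l P_l` has degree below `l`, it is
orthogonal to `P_l`, and the boundary values give `2 = (1 + 2 l) N`. -/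
theorem integral_legendre_sq (l : ℕ) :
    ∫ t in (-1 : ℝ)..1, (legendre l).eval t * (legendre l).eval t = 2 / (2 * l + 1) := by
  set N := ∫ t in (-1 : ℝ)..1, (legendre l).eval t * (legendre l).eval t with hN
  have h1 := integral_eval_derivative (X * legendre l * legendre l)
  have h2 : derivative (X * legendre l * legendre l) = legendre l * legendre l
      + C 2 * (C (l : ℝ) * (legendre l * legendre l)
        + legendre l * (X * derivative (legendre l) - C (l : ℝ) * legendre l)) := by
    simp only [derivative_mul, derivative_X, map_ofNat]
    ring
  have h3 : (X * derivative (legendre l) - C (l : ℝ) * legendre l).degree < (l : WithBot ℕ) := by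
    rw [degree_lt_iff_coeff_zero]
    intro m hm
    rcases m with _ | m
    · have : l = 0 := by omega
      simp [this]
    · rw [coeff_sub, coeff_X_mul, coeff_derivative, coeff_C_mul]
      rcases hm.eq_or_lt with h | h
      · rw [h]; push_cast; ring
      · rw [coeff_eq_zero_of_natDegree_lt (by rwa [legendre_natDegree])]
        ring
  have h4 := integral_legendre_mul_of_degree_lt h3
  rw [h2] at h1
  have hc : ∀ q : ℝ[X], IntervalIntegrable (fun t => q.eval t) MeasureTheory.volume (-1) 1 :=
    fun q => q.continuous.intervalIntegrable _ _
  have hsplit : ∀ p q : ℝ[X], ∫ t in (-1 : ℝ)..1, (p + q).eval t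
      = (∫ t in (-1 : ℝ)..1, p.eval t) + ∫ t in (-1 : ℝ)..1, q.eval t := by
    intro p q
    rw [← intervalIntegral.integral_add (hc p) (hc q)]; simp
  have hmul : ∀ (c : ℝ) (q : ℝ[X]), ∫ t in (-1 : ℝ)..1, (C c * q).eval t
      = c * ∫ t in (-1 : ℝ)..1, q.eval t := by
    intro c q
    rw [← intervalIntegral.integral_const_mul]; simp
  have hN' : ∫ t in (-1 : ℝ)..1, (legendre l * legendre l).eval t = N := by simp [hN]
  have h4' : ∫ t in (-1 : ℝ)..1, (legendre l *
      (X * derivative (legendre l) - C (l : ℝ) * legendre l)).eval t = 0 := by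
    simpa only [eval_mul] using h4
  rw [hsplit, hmul, hsplit, hmul, hN', h4'] at h1
  simp only [eval_mul, eval_X, legendre_eval_one, legendre_eval_neg] at h1
  have h5 : ((-1 : ℝ) ^ l) * (-1) ^ l = 1 := by rw [← mul_pow]; simp
  have h6 : (0 : ℝ) < 2 * l + 1 := by positivity
  field_simp
  linear_combination h1 + h5

/-- Parity reduces to `t ≥ 0`. With `k = l (l + 1)`, the energy `E = k P² + (1 - x²) P'²` has `E' =
2 x P'² ≥ 0` on `[0, 1]`, so `k P(t)² ≤ E(t) ≤ E(1) = k`. -/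
theorem abs_legendre_le_one (l : ℕ) {t : ℝ} (ht : t ∈ Set.Icc (-1 : ℝ) 1) :
    |(legendre l).eval t| ≤ 1 := by
  wlog h0 : 0 ≤ t generalizing t
  · have := this (t := -t) ⟨by linarith [ht.2], by linarith [ht.1]⟩ (by linarith)
    rw [legendre_eval_neg, abs_mul, abs_pow] at this
    simpa using this
  set k : ℝ := (l : ℝ) * (l + 1) with hk
  rcases Nat.eq_zero_or_pos l with rfl | hl
  · simp [legendre]
  have hk0 : 0 < k := by positivity
  set P := legendre l
  set E : ℝ[X] := C k * (P * P) + (1 - X ^ 2) * (derivative P * derivative P) with hE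
  have hE' : derivative E = 2 * X * derivative P ^ 2 := by
    have h := legendre_ode l
    have h2 : (1 - X ^ 2) * derivative (derivative P) = 2 * X * derivative P - C k * P := by
      rw [derivative_mul] at h
      simp at h
      have e : C k = (l : ℝ[X]) * (l + 1) := by simp [hk]
      rw [e]
      linear_combination h
    simp only [hE, derivative_add, derivative_mul, derivative_sub, derivative_C, derivative_one,
      derivative_X_sq, map_ofNat]
    linear_combination 2 * derivative P * h2
  have hmono : MonotoneOn (fun x => E.eval x) (Set.Icc 0 1) := by
    refine monotoneOn_of_deriv_nonneg (convex_Icc 0 1) E.continuous.continuousOn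
      E.differentiable.differentiableOn ?_
    intro x hx
    rw [interior_Icc] at hx
    rw [Polynomial.deriv, hE']
    have := hx.1.le
    simp only [eval_mul, eval_pow, eval_X, eval_ofNat]
    positivity
  have := hmono ⟨h0, ht.2⟩ ⟨zero_le_one, le_rfl⟩ ht.2
  simp only [hE, eval_add, eval_mul, eval_C, eval_pow, eval_sub, eval_one, eval_X] at this
  have hp1 : P.eval 1 = 1 := legendre_eval_one l
  rw [hp1] at this
  have h3 : 0 ≤ (1 - t ^ 2) * (derivative P).eval t ^ 2 := by
    have : 0 ≤ 1 - t ^ 2 := by nlinarith [ht.2]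
    positivity
  have h4 : P.eval t ^ 2 ≤ 1 := by
    have : k * P.eval t ^ 2 ≤ k * 1 := by nlinarith
    exact le_of_mul_le_mul_left this hk0
  exact abs_le_one_iff_mul_self_le_one.2 (by nlinarith)

/-! ### Parameter integrals, completeness of Legendre polynomials, the radial equation. -/

theorem hasDerivAt_integral_of_continuous {F F' : ℝ → ℝ → ℝ}
    (hF : ∀ r θ, HasDerivAt (fun r => F r θ) (F' r θ) r)
    (hFc : Continuous (Function.uncurry F)) (hFc' : Continuous (Function.uncurry F'))
    (a b r : ℝ) :
    HasDerivAt (fun r => ∫ θ in a..b, F r θ) (∫ θ in a..b, F' r θ) r := by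
  obtain ⟨M, hM⟩ := ((isCompact_Icc (a := r - 1) (b := r + 1)).prod
    (isCompact_uIcc (a := a) (b := b))).exists_bound_of_continuousOn hFc'.continuousOn
  have hc : ∀ r, Continuous (F r) := fun r => hFc.comp (Continuous.prodMk_right r)
  have hc' : ∀ r, Continuous (F' r) := fun r => hFc'.comp (Continuous.prodMk_right r)
  refine (intervalIntegral.hasDerivAt_integral_of_dominated_loc_of_deriv_le
    (F := F) (F' := F') (bound := fun _ => M)
    (s := Set.Icc (r - 1) (r + 1)) (Icc_mem_nhds (by linarith) (by linarith))
    (Filter.Eventually.of_forall fun r => (hc r).aestronglyMeasurable)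
    ((hc r).intervalIntegrable _ _) (hc' r).aestronglyMeasurable ?_
    intervalIntegrable_const ?_).2
  · exact Filter.Eventually.of_forall fun θ hθ x hx =>
      hM (x, θ) ⟨hx, Set.uIoc_subset_uIcc hθ⟩
  · exact Filter.Eventually.of_forall fun θ _ x _ => hF x θ

/-- A continuous function on `[-1, 1]` orthogonal to all polynomials vanishes. -/
theorem eq_zero_of_integral_polynomial {g : ℝ → ℝ} (hg : ContinuousOn g (Set.Icc (-1) 1))
    (h : ∀ q : ℝ[X], ∫ t in (-1 : ℝ)..1, g t * q.eval t = 0) :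
    ∀ t ∈ Set.Icc (-1 : ℝ) 1, g t = 0 := by
  have hIcc : Set.uIcc (-1 : ℝ) 1 = Set.Icc (-1) 1 := Set.uIcc_of_le (by norm_num)
  have hgi : ∀ f : ℝ → ℝ, ContinuousOn f (Set.Icc (-1) 1) →
      IntervalIntegrable f MeasureTheory.volume (-1) 1 := fun f hf =>
    ContinuousOn.intervalIntegrable (by rwa [hIcc])
  obtain ⟨M, hM⟩ := isCompact_Icc.exists_bound_of_continuousOn hg
  have hM0 : 0 ≤ M := (norm_nonneg _).trans (hM 0 ⟨by norm_num, by norm_num⟩)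
  have hsq : ∫ t in (-1 : ℝ)..1, g t ^ 2 ≤ 0 := by
    refine le_of_forall_pos_le_add fun ε hε => ?_
    -- Weierstrass approximation: `∫ g² = ∫ g (g - q)` for every polynomial `q`. The tolerance
    -- absorbs the bound `M` of `g` and the length `2` of the interval.
    obtain ⟨q, hq⟩ := exists_polynomial_near_of_continuousOn (-1) 1 g hg
      (ε / (2 * (M + 1))) (by positivity)
    have h1 : ∫ t in (-1 : ℝ)..1, g t ^ 2 = ∫ t in (-1 : ℝ)..1, g t * (g t - q.eval t) := by
      have e : ∀ t, g t * (g t - q.eval t) = g t ^ 2 - g t * q.eval t := fun t => by ring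
      simp_rw [e]
      rw [intervalIntegral.integral_sub (hgi (fun t => g t ^ 2) (hg.pow 2))
        (hgi (fun t => g t * q.eval t) (hg.mul q.continuous.continuousOn)), h q, sub_zero]
    rw [h1]
    have h2 := intervalIntegral.norm_integral_le_of_norm_le_const (a := (-1 : ℝ)) (b := 1)
      (f := fun t => g t * (g t - q.eval t)) (C := M * (ε / (2 * (M + 1)))) (by
        intro t ht
        have ht' : t ∈ Set.Icc (-1 : ℝ) 1 := hIcc ▸ Set.uIoc_subset_uIcc ht
        rw [norm_mul]
        refine mul_le_mul (hM t ht') ?_ (norm_nonneg _) hM0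
        rw [Real.norm_eq_abs, abs_sub_comm]
        exact (hq t ht').le)
    have h3 : M * (ε / (2 * (M + 1))) * |1 - (-1)| ≤ ε := by
      rw [show |(1 : ℝ) - (-1)| = 2 by norm_num]
      have : M * (ε / (2 * (M + 1))) * 2 = ε * (M / (M + 1)) := by field_simp
      rw [this]
      have : M / (M + 1) ≤ 1 := by rw [div_le_one (by positivity)]; linarith
      nlinarith
    rw [zero_add]
    exact (le_abs_self _).trans (h2.trans h3)
  intro t ht
  by_contra hne
  have hpos : 0 < ∫ t in (-1 : ℝ)..1, g t ^ 2 :=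
    intervalIntegral.integral_pos (by norm_num) (hg.pow 2) (fun x _ => sq_nonneg _)
      ⟨t, ht, by positivity⟩
  linarith

/-- A continuous function on `[-1, 1]` is the sum of its Legendre series if the coefficients are
summable. -/
theorem legendre_series_eq {g : ℝ → ℝ} (hg : ContinuousOn g (Set.Icc (-1) 1)) {B : ℕ → ℝ}
    (hB : Summable fun l => |B l|)
    (h : ∀ l, ∫ t in (-1 : ℝ)..1, g t * (legendre l).eval t = B l * (2 / (2 * l + 1))) :
    ∀ t ∈ Set.Icc (-1 : ℝ) 1, HasSum (fun l => B l * (legendre l).eval t) (g t) := by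
  have hIcc : Set.uIcc (-1 : ℝ) 1 = Set.Icc (-1) 1 := Set.uIcc_of_le (by norm_num)
  have hbd : ∀ l, ∀ t ∈ Set.Icc (-1 : ℝ) 1, ‖B l * (legendre l).eval t‖ ≤ |B l| := by
    intro l t ht
    rw [norm_mul, Real.norm_eq_abs, Real.norm_eq_abs]
    exact mul_le_of_le_one_right (abs_nonneg _) (abs_legendre_le_one l ht)
  have hs : ∀ t ∈ Set.Icc (-1 : ℝ) 1, Summable fun l => B l * (legendre l).eval t :=
    fun t ht => Summable.of_norm_bounded hB fun l => hbd l t ht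
  -- The sum converges uniformly, hence is continuous and may be integrated term by term; it has the
  -- same Legendre coefficients as `g`, and completeness yields `g = S`.
  set S : ℝ → ℝ := fun t => ∑' l, B l * (legendre l).eval t with hS
  have hSc : ContinuousOn S (Set.Icc (-1) 1) :=
    continuousOn_tsum (fun l => (continuous_const.mul (legendre l).continuous).continuousOn) hB hbd
  have hSm : ∀ m, ∫ t in (-1 : ℝ)..1, S t * (legendre m).eval t = B m * (2 / (2 * m + 1)) := by
    intro m
    have h1 := intervalIntegral.hasSum_integral_of_dominated_convergence (a := (-1 : ℝ)) (b := 1)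
      (μ := MeasureTheory.volume)
      (F := fun l t => B l * (legendre l).eval t * (legendre m).eval t)
      (f := fun t => S t * (legendre m).eval t) (fun l _ => |B l|)
      (fun l => ((continuous_const.mul (legendre l).continuous).mul
        (legendre m).continuous).aestronglyMeasurable)
      (fun l => Filter.Eventually.of_forall fun t ht => by
        have ht' : t ∈ Set.Icc (-1 : ℝ) 1 := hIcc ▸ Set.uIoc_subset_uIcc ht
        rw [norm_mul]
        exact (mul_le_of_le_one_right (norm_nonneg _) (abs_legendre_le_one m ht')).trans
          (hbd l t ht'))
      (Filter.Eventually.of_forall fun _ _ => hB) intervalIntegrable_const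
      (Filter.Eventually.of_forall fun t ht => by
        have ht' : t ∈ Set.Icc (-1 : ℝ) 1 := hIcc ▸ Set.uIoc_subset_uIcc ht
        exact (hs t ht').hasSum.mul_right _)
    refine h1.unique ?_
    have h2 : ∀ l, ∫ t in (-1 : ℝ)..1, B l * (legendre l).eval t * (legendre m).eval t
        = if l = m then B m * (2 / (2 * m + 1)) else 0 := by
      intro l
      simp_rw [mul_assoc]
      rw [intervalIntegral.integral_const_mul]
      split_ifs with hlm
      · rw [hlm, integral_legendre_sq]
      · rw [integral_legendre_mul_of_ne hlm, mul_zero]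
    simp_rw [h2]
    exact hasSum_ite_eq m _
  have hL : ∀ m, integralAgainst (fun t => g t - S t) (hg.sub hSc) (legendre m) = 0 := by
    intro m
    change ∫ t in (-1 : ℝ)..1, (g t - S t) * (legendre m).eval t = 0
    simp_rw [sub_mul]
    rw [intervalIntegral.integral_sub, h, hSm, sub_self]
    · exact ContinuousOn.intervalIntegrable (by
        rw [hIcc]; exact hg.mul (legendre m).continuous.continuousOn)
    · exact ContinuousOn.intervalIntegrable (by
        rw [hIcc]; exact hSc.mul (legendre m).continuous.continuousOn)
  have h0 := eq_zero_of_integral_polynomial (hg.sub hSc) fun q =>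
    eq_zero_of_legendre _ (q.natDegree + 1) (fun j _ => hL j) q
      (q.degree_le_natDegree.trans_lt (by exact_mod_cast Nat.lt_succ_self _))
  intro t ht
  have : g t = S t := sub_eq_zero.1 (h0 t ht)
  rw [this]
  exact (hs t ht).hasSum

/-- Bounded solutions of the radial equation `r² c'' + 2 r c' = l (l + 1) c` are multiples of
`r ^ l`. -/
theorem radial_equation {c c₁ c₂ : ℝ → ℝ} {R : ℝ} (l : ℕ)
    (h₁ : ∀ r, HasDerivAt c (c₁ r) r) (h₂ : ∀ r, HasDerivAt c₁ (c₂ r) r)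
    (heq : ∀ r ∈ Set.Ioo 0 R, r ^ 2 * c₂ r + 2 * r * c₁ r = l * (l + 1) * c r) :
    ∃ A, ∀ r ∈ Set.Ioo 0 R, c r = A * r ^ l := by
  -- The equation says that `v` is constant; `v` annihilates `r ^ l` but not the second solution `r
  -- ^ (-l-1)`. Regularity of `c` at `0` gives `v 0 = 0`, so `v` vanishes and `c / r ^ l` is
  -- constant.
  set v : ℝ → ℝ := fun r => r ^ (l + 1) * (r * c₁ r - l * c r) with hv
  have hv' : ∀ r ∈ Set.Ioo 0 R, HasDerivAt v 0 r := by
    intro r hr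
    have h := ((hasDerivAt_id r).pow (l + 1)).mul
      (((hasDerivAt_id r).mul (h₂ r)).sub ((h₁ r).const_mul (l : ℝ)))
    refine h.congr_deriv ?_
    simp only [id, Nat.add_sub_cancel, Pi.pow_apply, Pi.mul_apply, Pi.sub_apply]
    push_cast
    linear_combination r ^ l * heq r hr
  have hvc : Continuous v := by
    have hc : Continuous c := continuous_iff_continuousAt.2 fun r => (h₁ r).continuousAt
    have hc₁ : Continuous c₁ := continuous_iff_continuousAt.2 fun r => (h₂ r).continuousAt
    fun_prop
  have hv0 : ∀ r ∈ Set.Ioo 0 R, v r = 0 := by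
    intro r hr
    obtain ⟨ξ, hξ, h2⟩ := exists_hasDerivAt_eq_slope v (fun _ => 0) hr.1 hvc.continuousOn
      (fun x hx => hv' x ⟨hx.1, hx.2.trans hr.2⟩)
    have h3 : v 0 = 0 := by simp [hv]
    rw [h3, sub_zero, sub_zero, eq_comm, div_eq_zero_iff] at h2
    exact h2.resolve_right hr.1.ne'
  have hw : ∀ r ∈ Set.Ioo 0 R, HasDerivAt (fun r => c r / r ^ l) 0 r := by
    intro r hr
    have hr0 : r ≠ 0 := hr.1.ne'
    have h := (h₁ r).div ((hasDerivAt_id r).pow l) (by simp [hr0])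
    refine h.congr_deriv ?_
    have h1 := hv0 r hr
    simp only [hv, mul_eq_zero, pow_eq_zero_iff', hr0, false_and, false_or] at h1
    simp only [id, Pi.pow_apply]
    rcases l with _ | l
    · simp at h1 ⊢
      tauto
    · simp only [Nat.add_sub_cancel]
      push_cast at h1 ⊢
      rw [div_eq_zero_iff]; left
      linear_combination r ^ l * h1
  rcases le_or_gt R 0 with hR | hR
  · exact ⟨0, fun r hr => absurd (hr.1.trans hr.2) (by linarith)⟩
  refine ⟨c (R / 2) / (R / 2) ^ l, fun r hr => ?_⟩
  have hconst := isOpen_Ioo.is_const_of_deriv_eq_zero isPreconnected_Ioo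
    (fun x hx => (hw x hx).differentiableAt.differentiableWithinAt)
    (fun x hx => (hw x hx).deriv) hr (y := R / 2) ⟨by linarith, by linarith⟩
  rw [← hconst]
  have := hr.1
  field_simp

/-! ### Axisymmetric harmonic functions and their Legendre series. -/

/-- The Cartesian unit vectors. -/
abbrev unitVec (i : Fin 3) : E3 := EuclideanSpace.single i 1

theorem laplacian_eq_sum (f : E3 → ℝ) (x : E3) :
    Δ f x = fderiv ℝ (fderiv ℝ f) x (unitVec 0) (unitVec 0)
      + fderiv ℝ (fderiv ℝ f) x (unitVec 1) (unitVec 1)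
      + fderiv ℝ (fderiv ℝ f) x (unitVec 2) (unitVec 2) := by
  rw [InnerProductSpace.laplacian_eq_iteratedFDeriv_orthonormalBasis f
    (EuclideanSpace.basisFun (Fin 3) ℝ)]
  simp [Fin.sum_univ_three, iteratedFDeriv_two_apply]

theorem axis_coords {p : E3} (hp : p ∈ axis) : p 0 = 0 ∧ p 1 = 0 := by
  simp only [axis, rho, Set.mem_ofPred_eq] at hp
  rw [Real.sqrt_eq_zero (by positivity)] at hp
  constructor <;> nlinarith [sq_nonneg (p 0), sq_nonneg (p 1)]

/-- On the axis, the horizontal derivatives of an axisymmetric function vanish. -/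
theorem fderiv_horizontal_eq_zero {f : E3 → ℝ} {Ω : Set E3} (hΩ : IsOpen Ω)
    (hf : DependsOnRhoZeta f Ω) {p : E3} (hp : p ∈ Ω ∩ axis) {u : E3} (hu : u 2 = 0) :
    fderiv ℝ f p u = 0 := by
  by_cases hd : DifferentiableAt ℝ f p
  swap
  · simp [fderiv_zero_of_not_differentiableAt hd]
  have hp' := axis_coords hp.2
  -- Near `0` this is an even function: `p` is on the axis and `u` is horizontal, so `t ↦ -t`
  -- preserves `ρ` and `ζ`.
  set φ : ℝ → ℝ := fun t => f (p + t • u)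
  have hγ : ∀ t, HasDerivAt (fun t : ℝ => p + t • u) u t := fun t => by
    simpa using ((hasDerivAt_id t).smul_const u).const_add p
  have h1 : HasDerivAt φ (fderiv ℝ f p u) 0 := by
    have h := hd.hasFDerivAt
    exact HasFDerivAt.comp_hasDerivAt (0 : ℝ) (f := fun t : ℝ => p + t • u) (by simpa using h) (hγ 0)
  have h2 : HasDerivAt (fun t => φ (-t)) (-fderiv ℝ f p u) 0 := by
    have := HasDerivAt.scomp (0 : ℝ) (h := fun t : ℝ => -t) (g₁ := φ) (by simpa using h1)
      (hasDerivAt_neg 0)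
    simpa [Function.comp_def] using this
  have h3 : (fun t => φ (-t)) =ᶠ[𝓝 0] φ := by
    have hc : ∀ s : ℝ, ∀ᶠ t in 𝓝 (0 : ℝ), p + (s * t) • u ∈ Ω := fun s => by
      have hcont : ContinuousAt (fun t : ℝ => p + (s * t) • u) 0 := by fun_prop
      exact hcont.eventually_mem (hΩ.mem_nhds (by simpa using hp.1))
    filter_upwards [hc 1, hc (-1)] with t ht ht'
    refine hf _ (by simpa using ht') _ (by simpa using ht) ?_ ?_
    · simp [rho, hp']
    · simp [zeta, hu]
  have h4 := (h2.congr_of_eventuallyEq h3.symm).unique h1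
  linarith

theorem norm_sq_eq (x : E3) : ‖x‖ ^ 2 = x 0 ^ 2 + x 1 ^ 2 + x 2 ^ 2 := by
  rw [EuclideanSpace.norm_sq_eq]
  simp [Fin.sum_univ_three]

theorem mem_ball_iff {x : E3} {R : ℝ} (hR : 0 < R) :
    x ∈ Metric.ball (0 : E3) R ↔ x 0 ^ 2 + x 1 ^ 2 + x 2 ^ 2 < R ^ 2 := by
  rw [mem_ball_zero_iff, ← norm_sq_eq, pow_lt_pow_iff_left₀ (norm_nonneg _) hR.le two_ne_zero]

section Spherical

/-- The radial unit vector in the half-plane `φ = 0`. -/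
def radialVec (θ : ℝ) : E3 := Real.sin θ • unitVec 0 + Real.cos θ • unitVec 2

/-- The polar unit vector in the half-plane `φ = 0`. -/
def polarVec (θ : ℝ) : E3 := Real.cos θ • unitVec 0 - Real.sin θ • unitVec 2

theorem hasDerivAt_radialVec (θ : ℝ) : HasDerivAt radialVec (polarVec θ) θ := by
  have h := ((Real.hasDerivAt_sin θ).smul_const (unitVec 0)).add
    ((Real.hasDerivAt_cos θ).smul_const (unitVec 2))
  refine h.congr_deriv ?_
  rw [polarVec, neg_smul, sub_eq_add_neg]

theorem hasDerivAt_polarVec (θ : ℝ) : HasDerivAt polarVec (-radialVec θ) θ := by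
  have h := ((Real.hasDerivAt_cos θ).smul_const (unitVec 0)).sub
    ((Real.hasDerivAt_sin θ).smul_const (unitVec 2))
  refine h.congr_deriv ?_
  rw [radialVec, neg_smul]; abel

@[fun_prop]
theorem continuous_radialVec : Continuous radialVec :=
  continuous_iff_continuousAt.2 fun θ => (hasDerivAt_radialVec θ).continuousAt

theorem radialVec_apply (r θ : ℝ) : (r • radialVec θ) 0 = r * Real.sin θ ∧
    (r • radialVec θ) 1 = 0 ∧ (r • radialVec θ) 2 = r * Real.cos θ := by
  simp [radialVec]

theorem unitVec_zero_eq (θ : ℝ) :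
    unitVec 0 = Real.sin θ • radialVec θ + Real.cos θ • polarVec θ := by
  have h := Real.sin_sq_add_cos_sq θ
  simp only [radialVec, polarVec, smul_add, smul_sub, smul_smul]
  rw [show ∀ a b c d : E3, a + b + (c - d) = (a + c) + (b - d) from fun a b c d => by abel,
    ← add_smul, ← sub_smul]
  rw [show Real.sin θ * Real.sin θ + Real.cos θ * Real.cos θ = 1 by linarith,
    show Real.sin θ * Real.cos θ - Real.cos θ * Real.sin θ = 0 by ring]
  simp

theorem bilin_trace_eq (D : E3 →L[ℝ] E3 →L[ℝ] ℝ) (θ : ℝ) :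
    D (radialVec θ) (radialVec θ) + D (polarVec θ) (polarVec θ)
      = D (unitVec 0) (unitVec 0) + D (unitVec 2) (unitVec 2) := by
  have h := Real.sin_sq_add_cos_sq θ
  simp only [radialVec, polarVec, map_add, map_sub, map_smul, add_apply,
    sub_apply, smul_apply, smul_eq_mul]
  linear_combination (D (unitVec 0) (unitVec 0) + D (unitVec 2) (unitVec 2)) * h

variable {g : E3 → ℝ} {R : ℝ}

theorem radialVec_mem_ball {r θ : ℝ} (hr : |r| < R) : r • radialVec θ ∈ Metric.ball (0 : E3) R := by
  have hR : 0 < R := (abs_nonneg r).trans_lt hr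
  obtain ⟨h0, h1, h2⟩ := radialVec_apply r θ
  rw [mem_ball_iff hR, h0, h1, h2]
  have := Real.sin_sq_add_cos_sq θ
  have h3 : r ^ 2 < R ^ 2 := sq_lt_sq' (by linarith [(abs_lt.1 hr).1]) (abs_lt.1 hr).2
  linear_combination h3 + r ^ 2 * this

/-- Differentiating `g` twice along the horizontal circle of radius `ρ`, on which it is constant,
gives `ρ² g_yy - ρ g_x = 0` in the half-plane `φ = 0`. This expresses the azimuthal part of the
Laplacian by a first derivative. -/
theorem azimuthal_second_derivative (hg : ContDiff ℝ 2 g)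
    (hsymm : DependsOnRhoZeta g (Metric.ball 0 R)) (hR : 0 < R) {ρ z : ℝ}
    (h : ρ ^ 2 + z ^ 2 < R ^ 2) :
    ρ * fderiv ℝ (fderiv ℝ g) (ρ • unitVec 0 + z • unitVec 2) (unitVec 1) (unitVec 1)
      = fderiv ℝ g (ρ • unitVec 0 + z • unitVec 2) (unitVec 0) := by
  set γ : ℝ → E3 := fun α =>
    (ρ * Real.cos α) • unitVec 0 + (ρ * Real.sin α) • unitVec 1 + z • unitVec 2 with hγ
  set γ' : ℝ → E3 := fun α =>
    (ρ * -Real.sin α) • unitVec 0 + (ρ * Real.cos α) • unitVec 1 with hγ'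
  have hγc : ∀ α, γ α 0 = ρ * Real.cos α ∧ γ α 1 = ρ * Real.sin α ∧ γ α 2 = z := by
    intro α; simp [hγ]
  have hball : ∀ α, γ α ∈ Metric.ball (0 : E3) R := by
    intro α
    obtain ⟨h0, h1, h2⟩ := hγc α
    rw [mem_ball_iff hR, h0, h1, h2]
    have := Real.sin_sq_add_cos_sq α
    linear_combination h + ρ ^ 2 * this
  have hconst : ∀ α, g (γ α) = g (γ 0) := by
    intro α
    obtain ⟨h0, h1, h2⟩ := hγc α
    obtain ⟨k0, k1, k2⟩ := hγc 0
    refine hsymm _ (hball α) _ (hball 0) ?_ ?_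
    · rw [rho, rho, h0, h1, k0, k1]
      congr 1
      have := Real.sin_sq_add_cos_sq α
      simp only [Real.cos_zero, Real.sin_zero]
      linear_combination ρ ^ 2 * this
    · rw [zeta, zeta, h2, k2]
  have hd : ∀ α, HasDerivAt γ (γ' α) α := by
    intro α
    exact ((((Real.hasDerivAt_cos α).const_mul ρ).smul_const (unitVec 0)).add
      (((Real.hasDerivAt_sin α).const_mul ρ).smul_const (unitVec 1))).add_const _
  have hd' : HasDerivAt γ' ((ρ * -1) • unitVec 0) 0 := by
    have h := (((Real.hasDerivAt_sin 0).neg.const_mul ρ).smul_const (unitVec 0)).add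
      (((Real.hasDerivAt_cos 0).const_mul ρ).smul_const (unitVec 1))
    refine h.congr_deriv ?_
    simp
  have hgd : ∀ x, HasFDerivAt g (fderiv ℝ g x) x := fun x =>
    (hg.differentiable two_ne_zero x).hasFDerivAt
  have hgd2 : ∀ x, HasFDerivAt (fderiv ℝ g) (fderiv ℝ (fderiv ℝ g) x) x := fun x =>
    ((hg.fderiv_right (m := 1) le_rfl).differentiable one_ne_zero x).hasFDerivAt
  have h1 : ∀ α, fderiv ℝ g (γ α) (γ' α) = 0 := by
    intro α
    have h := (hgd (γ α)).comp_hasDerivAt α (hd α)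
    have h2 : g ∘ γ = fun _ => g (γ 0) := funext hconst
    rw [h2] at h
    exact h.unique (hasDerivAt_const α _)
  have h2 := ((hgd2 (γ 0)).comp_hasDerivAt 0 (hd 0)).clm_apply hd'
  have h3 : (fun α => ((fderiv ℝ g ∘ γ) α) (γ' α)) = fun _ => 0 := funext h1
  rw [h3] at h2
  have h4 := h2.unique (hasDerivAt_const 0 _)
  have e1 : γ 0 = ρ • unitVec 0 + z • unitVec 2 := by simp [hγ]
  have e2 : γ' 0 = ρ • unitVec 1 := by simp [hγ']
  rw [Function.comp_apply, e1, e2] at h4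
  simp only [map_smul, smul_apply, smul_eq_mul] at h4
  -- On the axis one cannot cancel `ρ`; there the claim is that a horizontal derivative vanishes.
  rcases eq_or_ne ρ 0 with rfl | hρ
  · rw [zero_mul, eq_comm]
    refine fderiv_horizontal_eq_zero Metric.isOpen_ball hsymm ⟨?_, ?_⟩ (by simp)
    · rw [← e1]; exact hball 0
    · simp [axis, rho]
  · have : ρ * (ρ * fderiv ℝ (fderiv ℝ g) (ρ • unitVec 0 + z • unitVec 2) (unitVec 1) (unitVec 1)
      - fderiv ℝ g (ρ • unitVec 0 + z • unitVec 2) (unitVec 0)) = 0 := by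
      linear_combination h4
    exact sub_eq_zero.1 ((mul_eq_zero.1 this).resolve_left hρ)

/-- The Laplace equation of an axisymmetric function in polar coordinates. -/
theorem laplace_polar (hg : ContDiff ℝ 2 g)
    (hsymm : DependsOnRhoZeta g (Metric.ball 0 R)) (hharm : ∀ x ∈ Metric.ball (0 : E3) R, Δ g x = 0)
    {r : ℝ} (hr : |r| < R) (θ : ℝ) :
    r * Real.sin θ * (fderiv ℝ (fderiv ℝ g) (r • radialVec θ) (radialVec θ) (radialVec θ)
        + fderiv ℝ (fderiv ℝ g) (r • radialVec θ) (polarVec θ) (polarVec θ))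
      + Real.sin θ * fderiv ℝ g (r • radialVec θ) (radialVec θ)
      + Real.cos θ * fderiv ℝ g (r • radialVec θ) (polarVec θ) = 0 := by
  have hR : 0 < R := (abs_nonneg r).trans_lt hr
  have h1 := hharm _ (radialVec_mem_ball (θ := θ) hr)
  rw [laplacian_eq_sum] at h1
  have h2 := azimuthal_second_derivative hg hsymm hR (ρ := r * Real.sin θ) (z := r * Real.cos θ) (by
    have := Real.sin_sq_add_cos_sq θ
    have h3 : r ^ 2 < R ^ 2 := sq_lt_sq' (by linarith [(abs_lt.1 hr).1]) (abs_lt.1 hr).2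
    linear_combination h3 + r ^ 2 * this)
  have e : (r * Real.sin θ) • unitVec 0 + (r * Real.cos θ) • unitVec 2 = r • radialVec θ := by
    rw [radialVec, smul_add, smul_smul, smul_smul]
  rw [e] at h2
  have h3 := bilin_trace_eq (fderiv ℝ (fderiv ℝ g) (r • radialVec θ)) θ
  have h4 : fderiv ℝ g (r • radialVec θ) (unitVec 0)
      = Real.sin θ * fderiv ℝ g (r • radialVec θ) (radialVec θ)
        + Real.cos θ * fderiv ℝ g (r • radialVec θ) (polarVec θ) := by
    conv_lhs => rw [unitVec_zero_eq θ]
    simp only [map_add, map_smul, smul_eq_mul]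
  rw [h3]
  linear_combination r * Real.sin θ * h1 - h2 - h4

/-- The Legendre coefficients of a harmonic axisymmetric function scale as `r ^ l`. -/
theorem legendre_coefficient_eq (hg : ContDiff ℝ 2 g)
    (hsymm : DependsOnRhoZeta g (Metric.ball 0 R)) (hharm : ∀ x ∈ Metric.ball (0 : E3) R, Δ g x = 0)
    (l : ℕ) :
    ∃ A, ∀ r ∈ Set.Ioo 0 R, ∫ θ in (0 : ℝ)..Real.pi,
      g (r • radialVec θ) * ((legendre l).eval (Real.cos θ) * Real.sin θ) = A * r ^ l := by
  have hgd : ∀ x, HasFDerivAt g (fderiv ℝ g x) x := fun x =>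
    (hg.differentiable two_ne_zero x).hasFDerivAt
  have hgC : ContDiff ℝ 1 (fderiv ℝ g) := hg.fderiv_right (m := 1) le_rfl
  have hgd2 : ∀ x, HasFDerivAt (fderiv ℝ g) (fderiv ℝ (fderiv ℝ g) x) x := fun x =>
    (hgC.differentiable one_ne_zero x).hasFDerivAt
  have hc0 : Continuous g := hg.continuous
  have hc1 : Continuous (fderiv ℝ g) := hgC.continuous
  have hc2 : Continuous (fderiv ℝ (fderiv ℝ g)) := hgC.continuous_fderiv one_ne_zero
  set P := legendre l
  set w : ℝ → ℝ := fun θ => P.eval (Real.cos θ) * Real.sin θ with hw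
  have hwc : Continuous w := (P.continuous.comp Real.continuous_cos).mul Real.continuous_sin
  have hx : ∀ r θ, HasDerivAt (fun r : ℝ => r • radialVec θ) (radialVec θ) r := fun r θ => by
    simpa using (hasDerivAt_id r).smul_const (radialVec θ)
  have hθ : ∀ r θ : ℝ, HasDerivAt (fun θ : ℝ => r • radialVec θ) (r • polarVec θ) θ := fun r θ =>
    HasDerivAt.fun_const_smul r (hasDerivAt_radialVec θ)
  have hd1 : ∀ r θ, HasDerivAt (fun r => g (r • radialVec θ) * w θ)
      (fderiv ℝ g (r • radialVec θ) (radialVec θ) * w θ) r := fun r θ =>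
    ((hgd _).comp_hasDerivAt r (hx r θ)).mul_const _
  have hd2 : ∀ r θ, HasDerivAt (fun r => fderiv ℝ g (r • radialVec θ) (radialVec θ) * w θ)
      (fderiv ℝ (fderiv ℝ g) (r • radialVec θ) (radialVec θ) (radialVec θ) * w θ) r := fun r θ => by
    have h := ((hgd2 _).comp_hasDerivAt r (hx r θ)).clm_apply (hasDerivAt_const r (radialVec θ))
    simpa using h.mul_const (w θ)
  have hF0 : Continuous (Function.uncurry fun (r θ : ℝ) => g (r • radialVec θ) * w θ) := by
    simp only [Function.uncurry_def]; fun_prop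
  have hF1 : Continuous (Function.uncurry fun (r θ : ℝ) =>
      fderiv ℝ g (r • radialVec θ) (radialVec θ) * w θ) := by
    simp only [Function.uncurry_def]; fun_prop
  have hF2 : Continuous (Function.uncurry fun (r θ : ℝ) =>
      fderiv ℝ (fderiv ℝ g) (r • radialVec θ) (radialVec θ) (radialVec θ) * w θ) := by
    simp only [Function.uncurry_def]; fun_prop
  refine radial_equation l
    (fun r => hasDerivAt_integral_of_continuous hd1 hF0 hF1 0 Real.pi r)
    (fun r => hasDerivAt_integral_of_continuous hd2 hF1 hF2 0 Real.pi r) ?_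
  intro r hr
  have hr' : |r| < R := by rw [abs_of_pos hr.1]; exact hr.2
  set q : ℝ[X] := (1 - X ^ 2) * derivative P with hq
  have hq' : derivative q = -(C ((l : ℝ) * (l + 1)) * P) := legendre_ode l
  -- Boundary term of two integrations by parts in `θ`: `sin θ` times the Wronskian of `g` and `P_l
  -- (cos θ)`. It vanishes at `0` and `π`, and its derivative is the integrand of the radial
  -- equation.
  set W : ℝ → ℝ := fun θ =>
    Real.sin θ * (r * fderiv ℝ g (r • radialVec θ) (polarVec θ)) * P.eval (Real.cos θ)
      + g (r • radialVec θ) * q.eval (Real.cos θ) with hW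
  have hcos : ∀ (p : ℝ[X]) θ, HasDerivAt (fun θ => p.eval (Real.cos θ))
      ((derivative p).eval (Real.cos θ) * (-Real.sin θ)) θ := fun p θ =>
    (p.hasDerivAt _).comp θ (Real.hasDerivAt_cos θ)
  have hWd : ∀ θ, HasDerivAt W (l * (l + 1) * (g (r • radialVec θ) * w θ)
      - (r ^ 2 * (fderiv ℝ (fderiv ℝ g) (r • radialVec θ) (radialVec θ) (radialVec θ) * w θ)
        + 2 * r * (fderiv ℝ g (r • radialVec θ) (radialVec θ) * w θ))) θ := by
    intro θ
    have h1 := ((hgd2 _).comp_hasDerivAt θ (hθ r θ)).clm_apply (hasDerivAt_polarVec θ)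
    have h2 := (((Real.hasDerivAt_sin θ).mul (h1.const_mul r)).mul (hcos P θ)).add
      (((hgd _).comp_hasDerivAt θ (hθ r θ)).mul (hcos q θ))
    refine h2.congr_deriv ?_
    have h3 := laplace_polar hg hsymm hharm hr' θ
    have h4 : Real.sin θ ^ 2 = 1 - Real.cos θ ^ 2 := by
      linear_combination Real.sin_sq_add_cos_sq θ
    simp only [Pi.mul_apply, Function.comp_apply, map_smul, map_neg, smul_apply, smul_eq_mul,
      hq', hw]
    simp only [hq, eval_neg, eval_mul, eval_C, eval_sub, eval_one, eval_pow, eval_X]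
    linear_combination r * P.eval (Real.cos θ) * h3
      - r * fderiv ℝ g (r • radialVec θ) (polarVec θ) * (derivative P).eval (Real.cos θ) * h4
  have hi : ∀ {F : ℝ → ℝ → ℝ}, Continuous (Function.uncurry F) →
      IntervalIntegrable (F r) MeasureTheory.volume 0 Real.pi := fun hF =>
    (hF.comp (Continuous.prodMk_right r)).intervalIntegrable _ _
  have hint := intervalIntegral.integral_eq_sub_of_hasDerivAt (a := 0) (b := Real.pi)
    (fun θ _ => hWd θ) ((((hi hF0).const_mul _).sub
      (((hi hF2).const_mul _).add ((hi hF1).const_mul _))))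
  rw [intervalIntegral.integral_sub ((hi hF0).const_mul _)
      (((hi hF2).const_mul _).add ((hi hF1).const_mul _)),
    intervalIntegral.integral_add ((hi hF2).const_mul _) ((hi hF1).const_mul _),
    intervalIntegral.integral_const_mul, intervalIntegral.integral_const_mul,
    intervalIntegral.integral_const_mul] at hint
  have hW0 : W Real.pi - W 0 = 0 := by simp [hW, hq]
  rw [hW0] at hint
  linear_combination -hint

/-- A harmonic axisymmetric function on a ball is the sum of its Legendre series. -/
theorem exists_legendre_series (hg : ContDiff ℝ 2 g)
    (hsymm : DependsOnRhoZeta g (Metric.ball 0 R))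
    (hharm : ∀ x ∈ Metric.ball (0 : E3) R, Δ g x = 0) :
    ∃ B : ℕ → ℝ, ∀ r ∈ Set.Ioo 0 R, ∀ θ ∈ Set.Icc 0 Real.pi,
      HasSum (fun l => B l * r ^ l * (legendre l).eval (Real.cos θ)) (g (r • radialVec θ)) := by
  choose A hA using legendre_coefficient_eq hg hsymm hharm
  have hc0 : Continuous g := hg.continuous
  -- The factor is the inverse of `∫ P_l² = 2 / (2 l + 1)`.
  refine ⟨fun l => (2 * l + 1) / 2 * A l, fun r hr θ hθ => ?_⟩
  -- On the larger sphere of radius `R'` the projections `A l * R' ^ l` are bounded in `l`, so at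
  -- radius `r` the coefficients are dominated by `(l + 1) (r / R')^l`.
  obtain ⟨R', hR'⟩ := exists_between hr.2
  have hR'0 : 0 < R' := hr.1.trans hR'.1
  have hbound : ∃ M, ∀ l, |A l| * R' ^ l ≤ M := by
    obtain ⟨M, hM⟩ := (isCompact_uIcc (a := 0) (b := Real.pi)).exists_bound_of_continuousOn
      (f := fun θ => g (R' • radialVec θ)) (by fun_prop)
    refine ⟨M * |Real.pi - 0|, fun l => ?_⟩
    have h1 := intervalIntegral.norm_integral_le_of_norm_le_const (a := 0) (b := Real.pi)
      (f := fun θ => g (R' • radialVec θ) * ((legendre l).eval (Real.cos θ) * Real.sin θ))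
      (C := M) (by
        intro x hx
        have h2 := hM x (Set.uIoc_subset_uIcc hx)
        rw [norm_mul, norm_mul]
        have h3 : ‖(legendre l).eval (Real.cos x)‖ ≤ 1 :=
          abs_legendre_le_one l ⟨Real.neg_one_le_cos x, Real.cos_le_one x⟩
        have h4 : ‖Real.sin x‖ ≤ 1 := Real.abs_sin_le_one x
        exact (mul_le_of_le_one_right (norm_nonneg _)
          (mul_le_one₀ h3 (norm_nonneg _) h4)).trans h2)
    rw [hA l R' ⟨hR'0, hR'.2⟩, norm_mul, Real.norm_eq_abs, Real.norm_eq_abs, abs_pow,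
      abs_of_pos hR'0] at h1
    exact h1
  obtain ⟨M, hM⟩ := hbound
  set x := r / R' with hx
  have hx0 : 0 ≤ x := div_nonneg hr.1.le hR'0.le
  have hx1 : ‖x‖ < 1 := by
    rw [Real.norm_eq_abs, abs_of_nonneg hx0, hx, div_lt_one hR'0]; exact hR'.1
  have hsum : Summable fun l : ℕ => |(2 * (l : ℝ) + 1) / 2 * A l * r ^ l| := by
    have hs := ((summable_pow_mul_geometric_of_norm_lt_one 1 hx1).mul_left M).add
      ((summable_geometric_of_norm_lt_one hx1).mul_left M)
    refine Summable.of_nonneg_of_le (fun _ => abs_nonneg _) (fun l => ?_) hs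
    have h1 : r = R' * x := by rw [hx]; field_simp
    have h2 : |A l| * R' ^ l * x ^ l ≤ M * x ^ l := by gcongr; exact hM l
    have h3 : 0 ≤ |A l| * R' ^ l * x ^ l := by positivity
    rw [abs_mul, abs_mul, abs_of_nonneg (by positivity : (0 : ℝ) ≤ (2 * l + 1) / 2), abs_pow,
      abs_of_pos hr.1]
    have h4 : (2 * (l : ℝ) + 1) / 2 * |A l| * r ^ l
        = (2 * (l : ℝ) + 1) / 2 * (|A l| * R' ^ l * x ^ l) := by rw [h1, mul_pow]; ring
    rw [h4]
    have h5 : (2 * (l : ℝ) + 1) / 2 ≤ l + 1 := by linarith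
    have h6 : (0 : ℝ) ≤ l + 1 := by positivity
    calc _ ≤ ((l : ℝ) + 1) * (|A l| * R' ^ l * x ^ l) := by gcongr
      _ ≤ ((l : ℝ) + 1) * (M * x ^ l) := by gcongr
      _ = _ := by simp; ring
  -- Substituting `t = cos θ` turns the projections over `[0, π]` into Legendre coefficients on
  -- `[-1, 1]`.
  have key := legendre_series_eq (g := fun t => g (r • radialVec (Real.arccos t)))
    (B := fun l => (2 * (l : ℝ) + 1) / 2 * A l * r ^ l)
    (by have := Real.continuous_arccos; fun_prop) hsum (by
      intro l
      have hG : Continuous fun t => -(g (r • radialVec (Real.arccos t)) * (legendre l).eval t) := by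
        have := Real.continuous_arccos
        have := (legendre l).continuous
        fun_prop
      have h1 := intervalIntegral.integral_comp_mul_deriv (a := 0) (b := Real.pi)
        (fun x _ => Real.hasDerivAt_cos x) (by fun_prop) hG
      rw [Real.cos_zero, Real.cos_pi, intervalIntegral.integral_neg,
        ← intervalIntegral.integral_symm] at h1
      rw [← h1]
      have h2 : (2 * (l : ℝ) + 1) / 2 * A l * r ^ l * (2 / (2 * l + 1)) = A l * r ^ l := by
        field_simp
      rw [h2, ← hA l r hr]
      refine intervalIntegral.integral_congr fun φ hφ => ?_
      rw [Set.uIcc_of_le Real.pi_pos.le] at hφ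
      simp only [Function.comp_apply, Real.arccos_cos hφ.1 hφ.2]
      ring)
  have := key (Real.cos θ) ⟨Real.neg_one_le_cos θ, Real.cos_le_one θ⟩
  simpa only [Real.arccos_cos hθ.1 hθ.2] using this

end Spherical

/-! ### Elementary flatness and the value of `k` on the axis. -/

theorem rho_sq (x : E3) : rho x ^ 2 = x 0 ^ 2 + x 1 ^ 2 := Real.sq_sqrt (by positivity)

/-- The differential lies in the `(ρ, ζ)` block, where the metric is a multiple of the identity. The
determinant `-ρ² E²` is nonzero off the axis, so `⁻¹` is there a genuine inverse. -/
theorem gradNormSq_eq {U a k f : E3 → ℝ} {x : E3} (hx : rho x ≠ 0) :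
    gradNormSq U a k f x = Real.exp (2 * U x - 2 * k x) * (dRho f x ^ 2 + dZeta f x ^ 2) := by
  set E := Real.exp (2 * k x - 2 * U x) with hE
  have hE0 : E ≠ 0 := (Real.exp_pos _).ne'
  have hEinv : Real.exp (2 * U x - 2 * k x) = E⁻¹ := by
    rw [hE, ← Real.exp_neg]; congr 1; ring
  have hdet : (metric U a k x).det = -(rho x ^ 2) * E ^ 2 := by
    have h1 : Real.exp (2 * U x) * Real.exp (-2 * U x) = 1 := by
      rw [← Real.exp_add]; simp
    rw [metric, Matrix.det_succ_row_zero]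
    simp [Fin.sum_univ_succ, Matrix.det_fin_three, Fin.succAbove, Matrix.submatrix_apply]
    rw [← hE]
    simp at h1
    linear_combination (-(rho x ^ 2) * E ^ 2) * h1
  have hu : IsUnit (metric U a k x).det := by
    rw [hdet, isUnit_iff_ne_zero]
    exact mul_ne_zero (neg_ne_zero.2 (pow_ne_zero _ hx)) (pow_ne_zero _ hE0)
  have h2 : (metric U a k x).mulVec (E⁻¹ • differential f x) = differential f x := by
    ext i
    fin_cases i <;>
      simp [metric, differential, Matrix.mulVec, dotProduct, Fin.sum_univ_four, ← hE, hE0]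
  have h3 : Matrix.mulVec (metric U a k x)⁻¹ (differential f x) = E⁻¹ • differential f x := by
    conv_lhs => rw [← h2]
    rw [Matrix.mulVec_mulVec, Matrix.nonsing_inv_mul _ hu, Matrix.one_mulVec]
  rw [gradNormSq, h3, hEinv]
  simp [differential, dotProduct, Fin.sum_univ_four]
  ring

theorem fderiv_axialNormSq {Ω : Set E3} {U a k : E3 → ℝ} {U₀ : ℝ} (hΩ : IsOpen Ω)
    (hU : ∀ x ∈ Ω, U x = U₀) {x : E3} (hx : x ∈ Ω) (ha : DifferentiableAt ℝ a x) (v : E3) :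
    fderiv ℝ (axialNormSq U a k) x v = Real.exp (-2 * U₀) * (2 * (x 0 * v 0 + x 1 * v 1))
      - Real.exp (2 * U₀) * (2 * a x * fderiv ℝ a x v) := by
  have h1 : axialNormSq U a k =ᶠ[𝓝 x] fun y =>
      Real.exp (-2 * U₀) * (y 0 ^ 2 + y 1 ^ 2) - Real.exp (2 * U₀) * a y ^ 2 := by
    filter_upwards [hΩ.mem_nhds hx] with y hy
    simp only [axialNormSq, metric, ← rho_sq, hU y hy]
    simp
  rw [h1.fderiv_eq]
  have hp : ∀ i : Fin 3, HasFDerivAt (fun y : E3 => y i) (EuclideanSpace.proj i : E3 →L[ℝ] ℝ) x :=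
    fun i => (EuclideanSpace.proj i : E3 →L[ℝ] ℝ).hasFDerivAt
  have h2 := ((((hp 0).pow 2).add ((hp 1).pow 2)).const_mul (Real.exp (-2 * U₀))).sub
    ((ha.hasFDerivAt.pow 2).const_mul (Real.exp (2 * U₀)))
  have h3 : HasFDerivAt (fun y : E3 =>
      Real.exp (-2 * U₀) * (y 0 ^ 2 + y 1 ^ 2) - Real.exp (2 * U₀) * a y ^ 2) _ x := h2
  rw [h3.fderiv]
  simp
  ring

/-- Elementary flatness forces `k = 0` on the axis if `U` is constant. -/
theorem k_eq_zero_on_axis {Ω : Set E3} {U a k : E3 → ℝ} {U₀ : ℝ} (hΩ : IsOpen Ω)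
    (hU : ∀ x ∈ Ω, U x = U₀) (hsymm : DependsOnRhoZeta a Ω) (ha : ContDiffOn ℝ 2 a Ω)
    (hk : ContDiffOn ℝ 2 k Ω) (hflat : ElementarilyFlat Ω U a k) {p : E3} (hp : p ∈ Ω ∩ axis) :
    k p = 0 := by
  have had : ∀ x ∈ Ω, DifferentiableAt ℝ a x := fun x hx =>
    (ha.contDiffAt (hΩ.mem_nhds hx)).differentiableAt two_ne_zero
  have hac : ∀ x ∈ Ω, ContinuousAt (fderiv ℝ a) x := fun x hx =>
    ((ha.contDiffAt (hΩ.mem_nhds hx)).fderiv_right (m := 1) le_rfl).continuousAt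
  -- the horizontal path issuing from a point of the axis
  have hpath : ∀ q ∈ Ω ∩ axis, Filter.Tendsto (fun t : ℝ => q + t • unitVec 0) (𝓝[>] 0) (𝓝 q) := by
    intro q _
    have : ContinuousAt (fun t : ℝ => q + t • unitVec 0) 0 := by fun_prop
    have h := this.tendsto
    simp only [zero_smul, add_zero] at h
    exact h.mono_left nhdsWithin_le_nhds
  have hrho : ∀ q ∈ Ω ∩ axis, ∀ t : ℝ, 0 < t → rho (q + t • unitVec 0) = t := by
    intro q hq t ht
    obtain ⟨h0, h1⟩ := axis_coords hq.2
    simp [rho, h0, h1, Real.sqrt_sq ht.le]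
  have hlim : ∀ q ∈ Ω ∩ axis, Filter.Tendsto (fun t : ℝ =>
      gradNormSq U a k (axialNormSq U a k) (q + t • unitVec 0)
        / (4 * axialNormSq U a k (q + t • unitVec 0))) (𝓝[>] 0) (𝓝 1) := by
    intro q hq
    refine (hflat q hq).comp (tendsto_nhdsWithin_iff.2 ⟨hpath q hq, ?_⟩)
    filter_upwards [self_mem_nhdsWithin] with t ht
    simp only [axis, Set.mem_compl_iff, Set.mem_ofPred_eq, hrho q hq t ht]
    exact (ne_of_gt ht)
  have hmem : ∀ q ∈ Ω ∩ axis, ∀ᶠ t : ℝ in 𝓝[>] 0, q + t • unitVec 0 ∈ Ω := fun q hq =>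
    (hpath q hq).eventually_mem (hΩ.mem_nhds hq.1)
  have hX : ∀ x ∈ Ω, axialNormSq U a k x
      = Real.exp (-2 * U₀) * rho x ^ 2 - Real.exp (2 * U₀) * a x ^ 2 := by
    intro x hx
    simp [axialNormSq, metric, hU x hx]
  -- Otherwise `X` tends to `-e^{2 U₀} a² < 0`, and the flatness quotient would be nonpositive near
  -- `q` instead of tending to `1`.
  have ha0 : ∀ q ∈ Ω ∩ axis, a q = 0 := by
    intro q hq
    by_contra hne
    have h1 : Filter.Tendsto (fun t : ℝ => Real.exp (-2 * U₀) * t ^ 2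
        - Real.exp (2 * U₀) * a (q + t • unitVec 0) ^ 2) (𝓝[>] 0)
        (𝓝 (Real.exp (-2 * U₀) * 0 ^ 2 - Real.exp (2 * U₀) * a q ^ 2)) :=
      (((Filter.tendsto_id.mono_right nhdsWithin_le_nhds).pow 2).const_mul _).sub
        ((((had q hq.1).continuousAt.tendsto.comp (hpath q hq)).pow 2).const_mul _)
    have h2 : Real.exp (-2 * U₀) * 0 ^ 2 - Real.exp (2 * U₀) * a q ^ 2 < 0 := by
      have := Real.exp_pos (2 * U₀)
      have : 0 < a q ^ 2 := by positivity
      simp only [ne_eq, OfNat.ofNat_ne_zero, not_false_eq_true, zero_pow, mul_zero, zero_sub,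
        neg_lt_zero]
      positivity
    obtain ⟨t, ht⟩ := (((h1.eventually_lt_const h2).and
      ((hlim q hq).eventually_const_lt zero_lt_one)).and
      ((hmem q hq).and self_mem_nhdsWithin)).exists
    obtain ⟨⟨h3, h4⟩, h5, h6⟩ := ht
    have hr := hrho q hq t h6
    rw [← hr] at h3
    nth_rewrite 2 [hr] at h3
    rw [← hX _ h5] at h3
    rw [gradNormSq_eq (by rw [hr]; exact (ne_of_gt h6))] at h4
    refine absurd h4 (not_lt.2 (div_nonpos_of_nonneg_of_nonpos ?_ (by linarith)))
    positivity
  have hDa0 : fderiv ℝ a p (unitVec 0) = 0 :=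
    fderiv_horizontal_eq_zero hΩ hsymm hp (by simp)
  -- `a = o(ρ)` along the path
  have hslope : Filter.Tendsto (fun t : ℝ => a (p + t • unitVec 0) / t) (𝓝[>] 0) (𝓝 0) := by
    have h1 : HasDerivAt (fun t : ℝ => p + t • unitVec 0) (unitVec 0) 0 := by
      simpa using ((hasDerivAt_id (0 : ℝ)).smul_const (unitVec 0)).const_add p
    have h2 := HasFDerivAt.comp_hasDerivAt (0 : ℝ) (l := a) (f := fun t : ℝ => p + t • unitVec 0)
      (by simpa using (had p hp.1).hasFDerivAt) h1
    rw [hDa0, hasDerivAt_iff_tendsto_slope] at h2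
    refine (h2.mono_left (nhdsWithin_mono _ fun t ht => ne_of_gt ht)).congr fun t => ?_
    simp [slope_def_field, ha0 p hp]
  have hD : ∀ v, Filter.Tendsto (fun t : ℝ => fderiv ℝ a (p + t • unitVec 0) v) (𝓝[>] 0)
      (𝓝 (fderiv ℝ a p v)) := fun v => by
    have h := (hac p hp.1).tendsto.comp (hpath p hp)
    exact ((ContinuousLinearMap.apply ℝ ℝ v).continuous.tendsto _).comp h
  have hkc : Filter.Tendsto (fun t : ℝ => k (p + t • unitVec 0)) (𝓝[>] 0) (𝓝 (k p)) :=
    (hk.contDiffAt (hΩ.mem_nhds hp.1)).continuousAt.tendsto.comp (hpath p hp)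
  set u := Real.exp (2 * U₀) with hu
  have hu0 : 0 < u := Real.exp_pos _
  have huinv : Real.exp (-2 * U₀) = u⁻¹ := by rw [hu, ← Real.exp_neg]; congr 1; ring
  -- The flatness quotient at distance `t` from the axis, with `t²` cancelled. Since `a / t → 0`,
  -- its limit is `e^{-2 k(p)}`, which must equal `1`.
  set Q : ℝ → ℝ := fun t => Real.exp (2 * U₀ - 2 * k (p + t • unitVec 0)) *
    ((2 * u⁻¹ - 2 * u * (a (p + t • unitVec 0) / t) * fderiv ℝ a (p + t • unitVec 0) (unitVec 0)) ^ 2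
      + (2 * u * (a (p + t • unitVec 0) / t) * fderiv ℝ a (p + t • unitVec 0) (unitVec 2)) ^ 2)
    / (4 * (u⁻¹ - u * (a (p + t • unitVec 0) / t) ^ 2)) with hQ
  have hQlim : Filter.Tendsto Q (𝓝[>] 0) (𝓝 (Real.exp (2 * U₀ - 2 * k p) *
      ((2 * u⁻¹ - 2 * u * 0 * fderiv ℝ a p (unitVec 0)) ^ 2
        + (2 * u * 0 * fderiv ℝ a p (unitVec 2)) ^ 2) / (4 * (u⁻¹ - u * 0 ^ 2)))) := by
    have hE := (Real.continuous_exp.tendsto _).comp ((hkc.const_mul 2).const_sub (2 * U₀))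
    refine Filter.Tendsto.div (hE.mul (Filter.Tendsto.add ?_ ?_)) ?_ ?_
    · exact (((hslope.const_mul (2 * u)).mul (hD _)).const_sub _).pow 2
    · exact ((hslope.const_mul (2 * u)).mul (hD _)).pow 2
    · exact (((hslope.pow 2).const_mul u).const_sub _).const_mul 4
    · simp [hu0.ne']
  have hQeq : ∀ᶠ t : ℝ in 𝓝[>] 0, gradNormSq U a k (axialNormSq U a k) (p + t • unitVec 0)
        / (4 * axialNormSq U a k (p + t • unitVec 0)) = Q t := by
    filter_upwards [hmem p hp, self_mem_nhdsWithin] with t ht ht0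
    have ht0' : (0 : ℝ) < t := ht0
    have hr := hrho p hp t ht0
    obtain ⟨h0, h1⟩ := axis_coords hp.2
    have hcoord : (p + t • unitVec 0) 0 = t ∧ (p + t • unitVec 0) 1 = 0 := by simp [h0, h1]
    have heR : eRho (p + t • unitVec 0) = unitVec 0 := by
      ext i
      fin_cases i <;> simp [eRho, hr, h0, h1, ht0'.ne']
    have heZ : eZeta = unitVec 2 := by
      ext i
      fin_cases i <;> simp [eZeta]
    rw [gradNormSq_eq (by rw [hr]; exact ht0'.ne'), hX _ ht, hU _ ht, dRho, dZeta, heR, heZ,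
      fderiv_axialNormSq hΩ hU ht (had _ ht), fderiv_axialNormSq hΩ hU ht (had _ ht),
      hcoord.1, hcoord.2, hr, huinv, ← hu, hQ]
    beta_reduce
    set α := a (p + t • unitVec 0) / t with hα
    have hα' : a (p + t • unitVec 0) = t * α := by rw [hα]; field_simp
    rw [hα']
    have ht2 : t ^ 2 ≠ 0 := by positivity
    refine Eq.trans ?_ (mul_div_mul_left _ _ ht2)
    congr 1
    · simp; ring
    · ring
  have hfin := tendsto_nhds_unique (hQlim.congr' (hQeq.mono fun _ h => h.symm)) (hlim p hp)
  have h1 : Real.exp (2 * U₀ - 2 * k p) = 1 * u := by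
    simp only [mul_zero, zero_mul, sub_zero, ne_eq, OfNat.ofNat_ne_zero, not_false_eq_true,
      zero_pow, add_zero] at hfin
    field_simp at hfin
    rw [show 2 * U₀ - 2 * k p = 2 * (U₀ - k p) by ring]
    linarith
  rw [one_mul, hu, Real.exp_eq_exp] at h1
  linarith

/-! ### Legendre coefficients as derivatives along the axis. -/

/-- The expansion is required only for `z ≠ 0`, because the Legendre series is available only for `r
> 0`; continuity supplies the value at `0`. -/
theorem iteratedDeriv_eq_of_hasSum {B : ℕ → ℝ} {h : ℝ → ℝ} {R : ℝ} (hR : 0 < R)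
    (hc : ContinuousAt h 0)
    (hsum : ∀ z, 0 < |z| → |z| < R → HasSum (fun l => B l * z ^ l) (h z)) (l : ℕ) :
    iteratedDeriv l h 0 = l.factorial * B l := by
  set p := FormalMultilinearSeries.ofScalars ℝ B with hp
  have hR2 : 0 < R / 2 := by linarith
  have hrad : 0 < p.radius := by
    have h1 : ((Real.toNNReal (R / 2) : NNReal) : ENNReal) ≤ p.radius := by
      refine p.le_radius_of_summable ?_
      have h2 := (hsum (R / 2) (by rw [abs_of_pos hR2]; exact hR2)
        (by rw [abs_of_pos hR2]; linarith)).summable.abs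
      refine h2.congr fun n => ?_
      rw [hp, FormalMultilinearSeries.ofScalars_norm, abs_mul, abs_pow, abs_of_pos hR2,
        Real.coe_toNNReal _ hR2.le, Real.norm_eq_abs]
    exact lt_of_lt_of_le (by rw [ENNReal.coe_pos, Real.toNNReal_pos]; exact hR2) h1
  have hball := p.hasFPowerSeriesOnBall hrad
  have heq : h =ᶠ[𝓝 0] p.sum := by
    rw [← hc.eventuallyEq_nhds_iff_eventuallyEq_nhdsNE hball.analyticAt.continuousAt]
    have h1 : ∀ᶠ z : ℝ in 𝓝[≠] 0, |z| < R := by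
      have : ∀ᶠ z : ℝ in 𝓝 0, |z| < R := by
        have := Metric.ball_mem_nhds (0 : ℝ) hR
        filter_upwards [this] with z hz
        simpa using hz
      exact this.filter_mono nhdsWithin_le_nhds
    filter_upwards [h1, self_mem_nhdsWithin] with z hz hz0
    have h2 := (hsum z (abs_pos.2 hz0) hz).tsum_eq
    rw [← h2]
    change _ = FormalMultilinearSeries.ofScalarsSum B z
    rw [FormalMultilinearSeries.ofScalars_sum_eq]
    simp
  rw [heq.iteratedDeriv_eq, iteratedDeriv_eq_iteratedFDeriv, ← hball.factorial_smul 1 l]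
  rw [hp, FormalMultilinearSeries.ofScalars_apply_eq]
  simp

theorem axisPoint_coords (z : ℝ) :
    (axisPoint z) 0 = 0 ∧ (axisPoint z) 1 = 0 ∧ (axisPoint z) 2 = z := by
  simp [axisPoint]

theorem axisPoint_mem_axis (z : ℝ) : axisPoint z ∈ axis := by
  obtain ⟨h0, h1, -⟩ := axisPoint_coords z
  simp [axis, rho, h0, h1]

theorem axisPoint_mem_ball {z σ : ℝ} (hz : |z| < σ) : axisPoint z ∈ Metric.ball (0 : E3) σ := by
  obtain ⟨h0, h1, h2⟩ := axisPoint_coords z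
  rw [mem_ball_iff ((abs_nonneg z).trans_lt hz), h0, h1, h2]
  nlinarith [abs_lt.1 hz, sq_lt_sq' (abs_lt.1 hz).1 (abs_lt.1 hz).2]

theorem axisPoint_eq (z : ℝ) : axisPoint z = z • unitVec 2 := by
  ext i
  fin_cases i <;> simp [axisPoint]

theorem axisPoint_zero : axisPoint 0 = 0 := by simp [axisPoint_eq]

theorem hasDerivAt_axisPoint (z : ℝ) : HasDerivAt axisPoint (unitVec 2) z := by
  have h := (hasDerivAt_id z).smul_const (unitVec 2)
  simp only [one_smul] at h
  exact h.congr_of_eventuallyEq (Filter.Eventually.of_forall axisPoint_eq)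

theorem sin_arccos_cos {θ : ℝ} (h : 0 ≤ Real.sin θ) :
    Real.sin (Real.arccos (Real.cos θ)) = Real.sin θ := by
  rw [Real.sin_arccos, ← Real.abs_sin_eq_sqrt_one_sub_cos_sq, abs_of_nonneg h]

theorem rho_smul_radialVec {r θ : ℝ} (hr : 0 ≤ r) (hθ : 0 ≤ Real.sin θ) :
    rho (r • radialVec θ) = r * Real.sin θ := by
  obtain ⟨h0, h1, -⟩ := radialVec_apply r θ
  rw [rho, h0, h1]
  simp only [ne_eq, OfNat.ofNat_ne_zero, not_false_eq_true, zero_pow, add_zero]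
  exact Real.sqrt_sq (mul_nonneg hr hθ)

/-- A `C²` function on an open ball agrees on a smaller ball with a `C²` function on the space. -/
theorem exists_contDiff_eqOn_ball {b : E3 → ℝ} {R σ : ℝ} (hR : 0 < R) (hRσ : R < σ)
    (hb : ContDiffOn ℝ 2 b (Metric.ball 0 σ)) :
    ∃ g : E3 → ℝ, ContDiff ℝ 2 g ∧ Set.EqOn g b (Metric.ball 0 R) := by
  let f : ContDiffBump (0 : E3) := ⟨R, (R + σ) / 2, hR, by linarith⟩
  refine ⟨fun x => f x * b x, contDiff_iff_contDiffAt.2 fun x => ?_, fun x hx => ?_⟩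
  · by_cases h1 : x ∈ tsupport f
    swap
    · rw [notMem_tsupport_iff_eventuallyEq] at h1
      refine (contDiffAt_const (c := (0 : ℝ))).congr_of_eventuallyEq ?_
      filter_upwards [h1] with y hy
      simp [hy]
    rw [f.tsupport_eq] at h1
    have h2 : x ∈ Metric.ball (0 : E3) σ :=
      Metric.closedBall_subset_ball (show (R + σ) / 2 < σ by linarith) h1
    exact f.contDiffAt.mul (hb.contDiffAt (Metric.isOpen_ball.mem_nhds h2))
  · have h1 : f x = 1 := f.one_of_mem_closedBall (Metric.ball_subset_closedBall hx)
    simp [h1]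

/-- At `θ = 0` and `θ = π` the Legendre series becomes a power series in `z` with the same
coefficients, which are therefore Taylor coefficients on the axis. -/
theorem hasSum_legendre_axis_derivs {b : E3 → ℝ} {σ : ℝ}
    (hb : ContDiffOn ℝ 2 b (Metric.ball 0 σ)) (hsymm : DependsOnRhoZeta b (Metric.ball 0 σ))
    (hharm : ∀ x ∈ Metric.ball (0 : E3) σ, Δ b x = 0) {x : E3} (hx : x ∈ Metric.ball (0 : E3) σ)
    {r θ : ℝ} (hr : 0 ≤ r) (hρ : rho x = r * Real.sin θ) (hζ : zeta x = r * Real.cos θ) :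
    HasSum (fun l : ℕ => iteratedDeriv l (fun z => b (axisPoint z)) 0 / l.factorial * r ^ l
      * (legendre l).eval (Real.cos θ)) (b x) := by
  have hnorm : ‖x‖ = r := by
    have h1 : ‖x‖ ^ 2 = r ^ 2 := by
      have h2 := rho_sq x
      have h3 : x 2 = r * Real.cos θ := hζ
      rw [norm_sq_eq, ← h2, hρ, h3]
      linear_combination r ^ 2 * Real.sin_sq_add_cos_sq θ
    exact (pow_left_inj₀ (norm_nonneg _) hr two_ne_zero).1 h1
  rcases hr.eq_or_lt with rfl | hr0
  · have hx0 : x = 0 := norm_eq_zero.1 hnorm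
    have h := hasSum_single (f := fun l : ℕ =>
      iteratedDeriv l (fun z => b (axisPoint z)) 0 / l.factorial * (0 : ℝ) ^ l
      * (legendre l).eval (Real.cos θ)) 0 (fun l hl => by simp [hl])
    simpa [axisPoint_zero, hx0, legendre] using h
  have hrσ : r < σ := by rw [← hnorm]; simpa using hx
  obtain ⟨R, hrR, hRσ⟩ := exists_between hrσ
  have hR : 0 < R := hr0.trans hrR
  have hsub : Metric.ball (0 : E3) R ⊆ Metric.ball 0 σ := Metric.ball_subset_ball hRσ.le
  -- The parameter integrals need a function that is `C²` on the whole space; symmetry and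
  -- harmonicity are kept on the ball of radius `R`.
  obtain ⟨g, hg, hgb⟩ := exists_contDiff_eqOn_ball hR hRσ hb
  have hgsymm : DependsOnRhoZeta g (Metric.ball 0 R) := by
    intro y hy y' hy' h1 h2
    rw [hgb hy, hgb hy']
    exact hsymm y (hsub hy) y' (hsub hy') h1 h2
  have hgharm : ∀ y ∈ Metric.ball (0 : E3) R, Δ g y = 0 := by
    intro y hy
    have h1 : g =ᶠ[𝓝 y] b := hgb.eventuallyEq_of_mem (Metric.isOpen_ball.mem_nhds hy)
    rw [(InnerProductSpace.laplacian_congr_nhds h1).eq_of_nhds]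
    exact hharm y (hsub hy)
  obtain ⟨B, hB⟩ := exists_legendre_series hg hgsymm hgharm
  have haxis : ∀ z, 0 < |z| → |z| < R → HasSum (fun l => B l * z ^ l) (g (axisPoint z)) := by
    intro z hz hzR
    rcases lt_or_gt_of_ne (abs_pos.1 hz) with hneg | hpos
    · have h := hB |z| ⟨hz, hzR⟩ Real.pi ⟨Real.pi_pos.le, le_rfl⟩
      rw [abs_of_neg hneg, Real.cos_pi] at h
      have e : (-z) • radialVec Real.pi = axisPoint z := by
        simp [radialVec, axisPoint_eq]
      rw [e] at h
      refine h.congr_fun fun l => ?_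
      rw [legendre_eval_neg, legendre_eval_one, mul_one, mul_assoc, ← mul_pow]
      simp
    · have h := hB |z| ⟨hz, hzR⟩ 0 ⟨le_rfl, Real.pi_pos.le⟩
      rw [abs_of_pos hpos, Real.cos_zero] at h
      have e : z • radialVec 0 = axisPoint z := by
        simp [radialVec, axisPoint_eq]
      rw [e] at h
      refine h.congr_fun fun l => ?_
      rw [legendre_eval_one, mul_one]
  have hcoef : ∀ l : ℕ, iteratedDeriv l (fun z => b (axisPoint z)) 0 / l.factorial = B l := by
    intro l
    have hcont : ContinuousAt (fun z => g (axisPoint z)) 0 :=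
      hg.continuous.continuousAt.comp (hasDerivAt_axisPoint 0).continuousAt
    have h1 : (fun z => b (axisPoint z)) =ᶠ[𝓝 0] fun z => g (axisPoint z) := by
      filter_upwards [Metric.ball_mem_nhds (0 : ℝ) hR] with z hz
      exact (hgb (axisPoint_mem_ball (by simpa using hz))).symm
    rw [h1.iteratedDeriv_eq, iteratedDeriv_eq_of_hasSum hR hcont haxis l]
    have := l.factorial_ne_zero
    field_simp
  simp_rw [hcoef]
  have hsin : 0 ≤ Real.sin θ := by
    have : 0 ≤ r * Real.sin θ := by rw [← hρ]; exact Real.sqrt_nonneg _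
    exact nonneg_of_mul_nonneg_right this hr0
  -- The angle `θ` is any real with `sin θ ≥ 0`; `θ'` is its representative in `[0, π]`.
  set θ' := Real.arccos (Real.cos θ) with hθ'
  have hcos : Real.cos θ' = Real.cos θ :=
    Real.cos_arccos (Real.neg_one_le_cos θ) (Real.cos_le_one θ)
  have hsin' : Real.sin θ' = Real.sin θ := sin_arccos_cos hsin
  have h := hB r ⟨hr0, hrR⟩ θ' ⟨Real.arccos_nonneg _, Real.arccos_le_pi _⟩
  rw [hcos] at h
  have hxR : x ∈ Metric.ball (0 : E3) R := by simpa [hnorm] using hrR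
  have hxe : g (r • radialVec θ') = b x := by
    rw [← hgb hxR]
    refine hgsymm _ (radialVec_mem_ball (by rwa [abs_of_pos hr0])) _ hxR ?_ ?_
    · rw [rho_smul_radialVec hr (by rw [hsin']; exact hsin), hsin', hρ]
    · rw [hζ, zeta, (radialVec_apply r θ').2.2, hcos]
  rwa [hxe] at h

/-! ### The field equations on the axis, the sign, and the theorem. -/

theorem norm_gradient_sq (f : E3 → ℝ) (x : E3) :
    ‖gradient f x‖ ^ 2 = fderiv ℝ f x (unitVec 0) ^ 2 + fderiv ℝ f x (unitVec 1) ^ 2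
      + fderiv ℝ f x (unitVec 2) ^ 2 := by
  have h : ∀ i, gradient f x i = fderiv ℝ f x (unitVec i) := by
    intro i
    rw [← toDual_gradient, InnerProductSpace.toDual_apply_apply]
    rw [EuclideanSpace.inner_single_right]
    simp only [starRingEnd_apply, star_trivial, one_mul]
  rw [norm_sq_eq, h, h, h]

/-- On the axis, `b_{,ζ} = ± √(8 π e^{2 U₀} μ)` with a constant sign. -/
theorem exists_sign_deriv_axis {Ω : Set E3} {U a k μ b : E3 → ℝ} {U₀ : ℝ}
    (hdust : RegularDust Ω U a k μ) (haxis : RegularAxis Ω U a k) (hU : ∀ x ∈ Ω, U x = U₀)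
    (hb : SolvesFieldEquations Ω U₀ k μ b) {σ : ℝ} (hσ : Metric.ball (0 : E3) σ ⊆ Ω) :
    ∃ s : ℝ, (s = 1 ∨ s = -1) ∧ ∀ z, |z| < σ → deriv (fun z => b (axisPoint z)) z
      = s * Real.sqrt (8 * Real.pi * Real.exp (2 * U₀)) * Real.sqrt (μ (axisPoint z)) := by
  set K := 8 * Real.pi * Real.exp (2 * U₀) with hK
  have hK0 : 0 < K := by positivity
  have hmem : ∀ z, |z| < σ → axisPoint z ∈ Ω ∩ axis := fun z hz =>
    ⟨hσ (axisPoint_mem_ball hz), axisPoint_mem_axis z⟩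
  have hbC : ∀ x ∈ Ω, ContDiffAt ℝ 2 b x := fun x hx =>
    hb.contDiffOn.contDiffAt (hdust.isOpen.mem_nhds hx)
  have hd : ∀ z, |z| < σ → deriv (fun z => b (axisPoint z)) z
      = fderiv ℝ b (axisPoint z) (unitVec 2) := fun z hz =>
    (((hbC _ (hmem z hz).1).differentiableAt two_ne_zero).hasFDerivAt.comp_hasDerivAt z
      (hasDerivAt_axisPoint z)).deriv
  have hsq : ∀ z, |z| < σ → deriv (fun z => b (axisPoint z)) z ^ 2 = K * μ (axisPoint z) := by
    intro z hz
    have h1 := hb.grad_sq _ (hmem z hz).1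
    rw [norm_gradient_sq, fderiv_horizontal_eq_zero hdust.isOpen hb.symm (hmem z hz) (by simp),
      fderiv_horizontal_eq_zero hdust.isOpen hb.symm (hmem z hz) (by simp),
      k_eq_zero_on_axis hdust.isOpen hU hdust.a_symm hdust.a_contDiffOn hdust.k_contDiffOn
        haxis.flat (hmem z hz)] at h1
    rw [hd z hz, hK]
    simp only [mul_zero, zero_add] at h1
    linear_combination h1
  have hcont : ContinuousOn (deriv fun z => b (axisPoint z)) {z | |z| < σ} := by
    have h1 : ContinuousOn (fun z => fderiv ℝ b (axisPoint z) (unitVec 2)) {z | |z| < σ} := by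
      intro z hz
      have h2 : ContinuousAt (fderiv ℝ b) (axisPoint z) :=
        ((hbC _ (hmem z hz).1).fderiv_right (m := 1) le_rfl).continuousAt
      exact ((ContinuousAt.comp h2 (hasDerivAt_axisPoint z).continuousAt).clm_apply
        continuousAt_const).continuousWithinAt
    exact h1.congr hd
  have hpre : IsPreconnected {z : ℝ | |z| < σ} := by
    have : {z : ℝ | |z| < σ} = Set.Ioo (-σ) σ := by ext z; simp [abs_lt]
    rw [this]; exact isPreconnected_Ioo
  have hμ : ∀ z, |z| < σ → 0 < μ (axisPoint z) := fun z hz =>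
    lt_of_le_of_ne (hdust.μ_nonneg _ (hmem z hz).1) (hdust.μ_ne_zero _ (hmem z hz).1).symm
  have hsqrt : ∀ z, |z| < σ → (Real.sqrt K * Real.sqrt (μ (axisPoint z))) ^ 2
      = K * μ (axisPoint z) := fun z hz => by
    rw [mul_pow, Real.sq_sqrt hK0.le, Real.sq_sqrt (hμ z hz).le]
  -- Continuity of `√μ` on the axis is read off from that of `|b_{,ζ}|`.
  have hcontμ : ContinuousOn (fun z => Real.sqrt K * Real.sqrt (μ (axisPoint z)))
      {z | |z| < σ} := by
    have h1 : ContinuousOn (fun z => |deriv (fun z => b (axisPoint z)) z|) {z | |z| < σ} :=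
      hcont.abs
    refine h1.congr fun z hz => ?_
    beta_reduce
    rw [← Real.sqrt_sq_eq_abs, hsq z hz, ← hsqrt z hz, Real.sqrt_sq (by positivity)]
  -- Two continuous functions with equal squares on an interval, one of them nowhere zero, agree up
  -- to a single sign.
  rcases hpre.eq_or_eq_neg_of_sq_eq hcont hcontμ
      (fun z hz => by simp only [Pi.pow_apply]; rw [hsq z hz, hsqrt z hz])
      (fun {z} hz => by have := hμ z hz; positivity) with h | h
  · exact ⟨1, Or.inl rfl, fun z hz => by rw [h hz]; ring⟩
  · exact ⟨-1, Or.inr rfl, fun z hz => by rw [h hz]; simp⟩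

theorem exists_sign_hasSum {Ω : Set E3} {U a k μ b : E3 → ℝ} {U₀ : ℝ}
    (hdust : RegularDust Ω U a k μ) (haxis : RegularAxis Ω U a k) (hU : ∀ x ∈ Ω, U x = U₀)
    (hb : SolvesFieldEquations Ω U₀ k μ b) {σ : ℝ} (hσ0 : 0 < σ)
    (hσ : Metric.ball (0 : E3) σ ⊆ Ω) :
    ∃ s : ℝ, (s = 1 ∨ s = -1) ∧ ∀ x ∈ Metric.ball (0 : E3) σ, ∀ r θ : ℝ, 0 ≤ r →
      rho x = r * Real.sin θ → zeta x = r * Real.cos θ →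
      HasSum (fun n => s * Real.sqrt (8 * Real.pi * Real.exp (2 * U₀)) * seriesTerm μ r θ n)
        (b x - b 0) := by
  obtain ⟨s, hs, hder⟩ := exists_sign_deriv_axis hdust haxis hU hb hσ
  refine ⟨s, hs, fun x hx r θ hr hρ hζ => ?_⟩
  have h := hasSum_legendre_axis_derivs (hb.contDiffOn.mono hσ)
    (fun y hy y' hy' => hb.symm y (hσ hy) y' (hσ hy')) (fun y hy => hb.harmonic y (hσ hy))
    hx hr hρ hζ
  -- Splits off the term `l = 0`, which is `b 0`; the remaining index is `n = l - 1`, and one of the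
  -- `l` axis derivatives is spent on `b_{,ζ}`.
  have h1 := (hasSum_nat_add_iff' 1).2 h
  have h0 : b x - ∑ i ∈ Finset.range 1, iteratedDeriv i (fun z => b (axisPoint z)) 0
      / i.factorial * r ^ i * (legendre i).eval (Real.cos θ) = b x - b 0 := by
    simp [axisPoint_zero, legendre]
  rw [h0] at h1
  refine h1.congr_fun fun n => ?_
  have h2 : deriv (fun z => b (axisPoint z)) =ᶠ[𝓝 0] fun z =>
      s * Real.sqrt (8 * Real.pi * Real.exp (2 * U₀)) * Real.sqrt (μ (axisPoint z)) := by
    filter_upwards [Metric.ball_mem_nhds (0 : ℝ) hσ0] with z hz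
    exact hder z (by simpa using hz)
  rw [iteratedDeriv_succ', h2.iteratedDeriv_eq, iteratedDeriv_const_mul_field, seriesTerm]
  ring

/-- Only derivatives of `b` enter the equations, linearly in the Laplace equation and quadratically
elsewhere, so a factor with `τ² = 1` drops out. -/
theorem SolvesFieldEquations.sign_mul_add_const {Ω : Set E3} {k μ b : E3 → ℝ} {U₀ : ℝ}
    (hb : SolvesFieldEquations Ω U₀ k μ b) {τ : ℝ} (hτ : τ * τ = 1) (d : ℝ) :
    SolvesFieldEquations Ω U₀ k μ (fun x => τ * b x + d) := by
  have hfd : fderiv ℝ (fun x => τ * b x + d) = τ • fderiv ℝ b := by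
    funext x
    rw [fderiv_add_const]
    have h : fderiv ℝ (τ • b) = τ • fderiv ℝ b := fderiv_const_smul_field τ
    exact congrFun h x
  have hfd2 : fderiv ℝ (τ • fderiv ℝ b) = τ • fderiv ℝ (fderiv ℝ b) :=
    fderiv_const_smul_field (f := fderiv ℝ b) τ
  have hρ : ∀ x, dRho (fun x => τ * b x + d) x = τ * dRho b x := fun x => by
    simp only [dRho, hfd, Pi.smul_apply, smul_apply, smul_eq_mul]
  have hζ : ∀ x, dZeta (fun x => τ * b x + d) x = τ * dZeta b x := fun x => by
    simp only [dZeta, hfd, Pi.smul_apply, smul_apply, smul_eq_mul]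
  refine ⟨(contDiffOn_const.mul hb.contDiffOn).add contDiffOn_const, ?_, ?_, ?_, ?_, ?_⟩
  · intro x hx y hy h1 h2
    simp only [hb.symm x hx y hy h1 h2]
  · intro x hx
    have h := hb.harmonic x hx
    rw [laplacian_eq_sum] at h ⊢
    rw [hfd, hfd2]
    simp only [Pi.smul_apply, smul_apply, smul_eq_mul]
    linear_combination τ * h
  · intro x hx
    rw [← hb.grad_sq x hx, norm_gradient_sq, norm_gradient_sq, hfd]
    simp only [Pi.smul_apply, smul_apply, smul_eq_mul]
    linear_combination (fderiv ℝ b x (unitVec 0) ^ 2 + fderiv ℝ b x (unitVec 1) ^ 2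
      + fderiv ℝ b x (unitVec 2) ^ 2) * hτ
  · intro x hx
    rw [hb.k_rho x hx, hρ, hζ]
    linear_combination (-(Real.exp (-4 * U₀) / 4 * (rho x * (dRho b x ^ 2 - dZeta b x ^ 2)))) * hτ
  · intro x hx
    rw [hb.k_zeta x hx, hρ, hζ]
    linear_combination (-(Real.exp (-4 * U₀) / 4 * (rho x * (2 * dRho b x * dZeta b x)))) * hτ

end RotatingDust

end

open RotatingDust in
theorem theorem2 (Ω : Set E3) (U a k μ : E3 → ℝ) (U₀ : ℝ)
    (hdust : RegularDust Ω U a k μ) (haxis : RegularAxis Ω U a k)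
    (hU : ∀ x ∈ Ω, U x = U₀)
    (p : FormalMultilinearSeries ℝ ℝ ℝ) (ε : ENNReal)
    (hμ : HasFPowerSeriesAt (fun z => μ (axisPoint z)) p 0) (hε : p.radius = ε)
    (b : E3 → ℝ) (hb : SolvesFieldEquations Ω U₀ k μ b) :
    (∃ σ : ℝ, 0 < σ ∧ Metric.ball (0 : E3) σ ⊆ Metric.eball (0 : E3) ε ∩ Ω) ∧
    ∀ σ : ℝ, 0 < σ → Metric.ball (0 : E3) σ ⊆ Metric.eball (0 : E3) ε ∩ Ω →
      (∃ s : ℝ, (s = 1 ∨ s = -1) ∧ HasLocalForm U₀ μ σ (b 0) s b) ∧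
      (∀ c s : ℝ, (s = 1 ∨ s = -1) →
        ∃ b' : E3 → ℝ, SolvesFieldEquations Ω U₀ k μ b' ∧ b' 0 = c ∧
          HasLocalForm U₀ μ σ c s b') := by
  constructor
  · have hε0 : 0 < ε := hε ▸ hμ.radius_pos
    have h1 : Metric.eball (0 : E3) ε ∩ Ω ∈ nhds (0 : E3) :=
      Filter.inter_mem (Metric.eball_mem_nhds _ hε0) (hdust.isOpen.mem_nhds haxis.origin_mem.1)
    obtain ⟨σ, hσ, h⟩ := Metric.mem_nhds_iff.1 h1
    exact ⟨σ, hσ, h⟩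
  intro σ hσ0 hsub
  have hσ : Metric.ball (0 : E3) σ ⊆ Ω := hsub.trans Set.inter_subset_right
  obtain ⟨s₀, hs₀, hsum⟩ := exists_sign_hasSum hdust haxis hU hb hσ0 hσ
  set K := Real.sqrt (8 * Real.pi * Real.exp (2 * U₀)) with hK
  have hK0 : K ≠ 0 := by rw [hK]; positivity
  have hs₀0 : s₀ ≠ 0 := by rcases hs₀ with rfl | rfl <;> norm_num
  have hs₀1 : s₀ * s₀ = 1 := by rcases hs₀ with rfl | rfl <;> norm_num
  have hser : ∀ x ∈ Metric.ball (0 : E3) σ, ∀ r θ : ℝ, 0 ≤ r →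
      rho x = r * Real.sin θ → zeta x = r * Real.cos θ →
      Summable (seriesTerm μ r θ) ∧ b x - b 0 = s₀ * K * ∑' n, seriesTerm μ r θ n := by
    intro x hx r θ hr hρ hζ
    have h := hsum x hx r θ hr hρ hζ
    exact ⟨(summable_mul_left_iff (mul_ne_zero hs₀0 hK0)).1 h.summable,
      by rw [← tsum_mul_left, h.tsum_eq]⟩
  refine ⟨⟨s₀, hs₀, fun x hx r θ hr hρ hζ => ?_⟩, fun c s hs => ?_⟩
  · obtain ⟨h1, h2⟩ := hser x hx r θ hr hρ hζ
    exact ⟨h1, by linear_combination h2⟩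
  · have hs1 : s * s = 1 := by rcases hs with rfl | rfl <;> norm_num
    -- The factor `s * s₀` replaces the sign `s₀` of `b` by `s`, as `s₀² = 1`; the constant makes
    -- the value at the origin `c`.
    refine ⟨fun x => (s * s₀) * b x + (c - s * s₀ * b 0),
      hb.sign_mul_add_const (by linear_combination hs1 + s * s * hs₀1) _,
      by ring, fun x hx r θ hr hρ hζ => ?_⟩
    obtain ⟨h1, h2⟩ := hser x hx r θ hr hρ hζ
    exact ⟨h1, by linear_combination s * s₀ * h2 + s * K * (∑' n, seriesTerm μ r θ n) * hs₀1⟩
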